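/- Let $\Omega\subset\mathbb R^2$ be a bounded simply connected domain whose boundary is a simple closed $C^1$ curve, with unit tangent field $\mathbf t$ and unit normal field $\mathbf n$, and let $g$ be (the restriction to $\partial\Omega$ of) a smooth function on $\mathbb R^2$. For all sufficiently small $\varepsilon>0$ let $(\mathbf u^\varepsilon,p^\varepsilon)$, with $\mathbf u^\varepsilon\in C^2(\Omega)\cap C(\overline\Omega)$ and $p^\varepsilon\in C^1(\Omega)$, be a solution of the steady Navier–Stokes equations $$\mathbf u^\varepsilon\cdot\nabla\mathbf u^\varepsilon+\nabla p^\varepsilon-\varepsilon^2\Delta\mathbf u^\varepsilon=0,\qquad \nabla\cdot\mathbf u^\varepsilon=0\quad\text{in }\Omega,\qquad \mathbf u^\varepsilon\cdot\mathbf n|_{\partial\Omega}=0,\quad \mathbf u^\varepsilon\cdot\mathbf t|_{\partial\Omega}=g,$$ and let $\psi^\varepsilon$ be its stream function, i.e. $\mathbf u^\varepsilon=(\partial_y\psi^\varepsilon,-\partial_x\psi^\varepsilon)$ in $\Omega$, $\psi^\varepsilon$ is continuous on $\overline\Omega$ and $\psi^\varepsilon|_{\partial\Omega}=0$. Assume that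 (i) for all sufficiently small $\varepsilon>0$, $\psi^\varepsilon$ has no hyperbolic critical point in $\Omega$, i.e. no point where $\nabla\psi^\varepsilon=0$ and $\det D^2\psi^\varepsilon<0$ (in particular this holds for a single eddy, that is, when the streamlines are nested closed curves); (ii) $\mathbf u^\varepsilon\to\mathbf u^e$ in $C^2(K)$ as $\varepsilon\to0^+$ for every compact $K\subset\Omega$, where $\mathbf u^e\in C^2(\Omega)\cap C(\overline\Omega)$, with some pressure $p^e\in C^1(\Omega)$, solves the steady Euler equations $\mathbf u^e\cdot\nabla\mathbf u^e+\nabla p^e=0$, $\nabla\cdot\mathbf u^e=0$ in $\Omega$ with $\mathbf u^e\cdot\mathbf n|_{\partial\Omega}=0$. Then the vorticity $w^e=\nabla\times\mathbf u^e=\partial_xu^e_2-\partial_yu^e_1$ is equal to a constant $a$ in $\Omega$. If moreover $\Omega$ is the unit disk $B_1(0)$, then $\mathbf u^e$ is the rigid rotation $\mathbf u^e(x,y)=\frac a2(-y,x)$, i.e. in polar coordinates its tangential component is $\frac a2 r$ and its radial component is $0$. -/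

import Mathlib

open Set Filter Topology
open scoped ContDiff Laplacian Gradient

namespace PrandtlBatchelor

/-- The Euclidean plane. -/
abbrev Plane : Type := EuclideanSpace ℝ (Fin 2)

noncomputable section

/-- Rotation of a vector by `π / 2`: `(x, y) ↦ (-y, x)`. -/
def rot (v : Plane) : Plane := !₂[-v 1, v 0]

/-- The `i`-th vector of the standard basis. -/
def e (i : Fin 2) : Plane := EuclideanSpace.single i 1

/-- The divergence `∂ₓ u₀ + ∂_y u₁` of a planar vector field. -/
def divergence (u : Plane → Plane) (x : Plane) : ℝ :=
  fderiv ℝ u x (e 0) 0 + fderiv ℝ u x (e 1) 1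

/-- The (scalar) vorticity `∇ × u = ∂ₓ u₁ - ∂_y u₀` of a planar vector field. -/
def vorticity (u : Plane → Plane) (x : Plane) : ℝ :=
  fderiv ℝ u x (e 0) 1 - fderiv ℝ u x (e 1) 0

/-- The convective term `u · ∇ u`: the derivative of `u` in the direction `u`. -/
def convection (u : Plane → Plane) (x : Plane) : Plane := fderiv ℝ u x (u x)

/-- `γ` is an arc-length parametrization, of period `L`, of a simple closed `C¹` curve. -/
structure IsJordanParam (γ : ℝ → Plane) (L : ℝ) : Prop where
  length_pos : 0 < L
  contDiff : ContDiff ℝ 1 γ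
  periodic : Function.Periodic γ L
  unit_speed : ∀ s, ‖deriv γ s‖ = 1
  injOn : InjOn γ (Ico 0 L)

/-- `Ω` is a bounded simply connected domain of the plane whose boundary is the simple closed
`C¹` curve parametrized by arc length by `γ`. -/
structure IsEddyDomain (Ω : Set Plane) (γ : ℝ → Plane) (L : ℝ) : Prop where
  isOpen : IsOpen Ω
  isBounded : Bornology.IsBounded Ω
  simplyConnected : SimplyConnectedSpace Ω
  param : IsJordanParam γ L
  frontier_eq : frontier Ω = range γ

/-- The unit tangent vector to the boundary at `γ s`. -/
def tangent (γ : ℝ → Plane) (s : ℝ) : Plane := deriv γ s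

/-- The unit normal vector to the boundary at `γ s` (the outward one if `γ` runs
counterclockwise). -/
def normal (γ : ℝ → Plane) (s : ℝ) : Plane := -rot (deriv γ s)

/-- `(u, p)` is a classical solution of the steady Navier-Stokes equations in `Ω`,
`u · ∇ u + ∇ p - ε² Δ u = 0`, `∇ · u = 0`, with boundary values `u · n = 0` and `u · t = g`. -/
structure IsSteadyNavierStokes (Ω : Set Plane) (γ : ℝ → Plane) (g : Plane → ℝ) (ε : ℝ)
    (u : Plane → Plane) (p : Plane → ℝ) : Prop where
  contDiffOn_velocity : ContDiffOn ℝ 2 u Ω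
  continuousOn_velocity : ContinuousOn u (closure Ω)
  contDiffOn_pressure : ContDiffOn ℝ 1 p Ω
  momentum : ∀ x ∈ Ω, convection u x + ∇ p x - ε ^ 2 • Δ u x = 0
  incompressible : ∀ x ∈ Ω, divergence u x = 0
  boundary_normal : ∀ s, inner ℝ (u (γ s)) (normal γ s) = 0
  boundary_tangent : ∀ s, inner ℝ (u (γ s)) (tangent γ s) = g (γ s)

/-- `(u, p)` is a classical solution of the steady Euler equations in `Ω`,
`u · ∇ u + ∇ p = 0`, `∇ · u = 0`, with impermeable boundary, `u · n = 0`. -/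
structure IsSteadyEuler (Ω : Set Plane) (γ : ℝ → Plane)
    (u : Plane → Plane) (p : Plane → ℝ) : Prop where
  contDiffOn_velocity : ContDiffOn ℝ 1 u Ω
  continuousOn_velocity : ContinuousOn u (closure Ω)
  contDiffOn_pressure : ContDiffOn ℝ 1 p Ω
  momentum : ∀ x ∈ Ω, convection u x + ∇ p x = 0
  incompressible : ∀ x ∈ Ω, divergence u x = 0
  boundary_normal : ∀ s, inner ℝ (u (γ s)) (normal γ s) = 0

/-- `ψ` is the stream function of the field `u` in `Ω`: `u = (∂_y ψ, -∂ₓ ψ)` in `Ω`, and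
`ψ = 0` on the boundary. -/
structure IsStreamFunction (Ω : Set Plane) (u : Plane → Plane) (ψ : Plane → ℝ) : Prop where
  differentiableOn : DifferentiableOn ℝ ψ Ω
  continuousOn : ContinuousOn ψ (closure Ω)
  velocity_eq : ∀ x ∈ Ω, u x = !₂[∇ ψ x 1, -∇ ψ x 0]
  boundary : ∀ x ∈ frontier Ω, ψ x = 0

/-- The Hessian matrix of `ψ`: its `(i, j)` entry is `∂ᵢ ∂ⱼ ψ`. -/
def hessian (ψ : Plane → ℝ) (x : Plane) : Matrix (Fin 2) (Fin 2) ℝ :=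
  Matrix.of fun i j => fderiv ℝ (fun y => fderiv ℝ ψ y (e j)) x (e i)

/-- `x` is a hyperbolic critical point (a nondegenerate saddle) of `ψ`: the gradient vanishes and
the Hessian has a positive and a negative eigenvalue. -/
def IsHyperbolicCriticalPoint (ψ : Plane → ℝ) (x : Plane) : Prop :=
  ∇ ψ x = 0 ∧ (hessian ψ x).det < 0

/-- `u ε` converges to `v` as `ε → 0⁺` in `C²(K)`, for every compact subset `K` of `Ω`. -/
structure ConvergesC2Loc (Ω : Set Plane) (u : ℝ → Plane → Plane) (v : Plane → Plane) :
    Prop where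
  contDiffOn_limit : ContDiffOn ℝ 2 v Ω
  tendsto : ∀ K ⊆ Ω, IsCompact K → ∀ k ≤ 2,
    TendstoUniformlyOn (fun ε => iteratedFDeriv ℝ k (u ε)) (iteratedFDeriv ℝ k v) (𝓝[>] 0) K

end

end PrandtlBatchelor

/-!
The limit flow `ue` has a stream function `Ψ`, the limit of the stream functions `ψ ε` normalized by
constants (`exists_hasStream_limit`), and it transports its vorticity `ω`
(`fderiv_vorticity_velocity`). Where `ue ≠ 0` this makes `ω` locally a function `F(Ψ)`, and the
claim is that `F' = 0`.

The viscous term decides this. A steady Navier-Stokes flow does no viscous work on its streamlines: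
`u · ∇ u + ∇ p` paired with `u` is the derivative of the Bernoulli function `|u|² / 2 + p` along
`u`, so that `∫ χ η(ψ) u · Δ u = 0` whenever `η(ψ) χ` is constant along the flow
(`integral_inner_laplacian_eq_zero`). After division by `ε²` nothing is lost as `ε → 0`, so
the limit flow has the same property. On the other hand `ue · Δ ue` is, up to the sign, the
derivative of `ω` across the streamlines, that is `F'(Ψ) |ue|²` (`inner_laplacian`). If `F'` did not
vanish at some point, let `c` be a nearby value of `Ψ` such that the level set `{Ψ = c}` is compact
in `Ω` and free of critical points. As `F'` is locally constant on that level set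
(`exists_nhds_ratio_eq`), the part of it on which `F'` has a given sign is open and closed in it. A
cutoff around this part turns the integral above into the integral of a function of one sign which
is not zero (`fderiv_vorticity_rot_eq_zero`).

Almost every `c` is admissible. Critical values are negligible by Sard's theorem, which is proved
through Hausdorff dimension (`volume_image_critical_eq_zero`). Since `ue` is tangent to the `C¹`
boundary, `Ψ` has only finitely many limiting values there, and every other level set is compact
(`exists_finite_isCompact_level`).

In the disk, subtracting the rigid rotation leaves a field `v` without divergence and curl which is
tangent to the circle. Then `z (v₀ - i v₁)` is holomorphic with vanishing real part on the circle,
and it vanishes at the origin, so it is zero.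
-/

namespace PrandtlBatchelor

open MeasureTheory

noncomputable section

/-! ### Planar linear algebra -/

/-- The rotation `rot` as a continuous linear map. -/
def rotL : Plane →L[ℝ] Plane :=
  LinearMap.toContinuousLinearMap
    { toFun := rot
      map_add' := fun v w => by
        ext i; fin_cases i <;> simp [rot, add_comm]
      map_smul' := fun c v => by
        ext i; fin_cases i <;> simp [rot] }

@[simp] theorem rotL_apply (v : Plane) : rotL v = rot v := rfl

@[simp] theorem rot_apply_zero (v : Plane) : rot v 0 = -v 1 := by simp [rot]

@[simp] theorem rot_apply_one (v : Plane) : rot v 1 = v 0 := by simp [rot]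

theorem continuous_rot : Continuous rot := rotL.continuous

theorem inner_eq (v w : Plane) : inner ℝ v w = v 0 * w 0 + v 1 * w 1 := by
  simp [PiLp.inner_apply, Fin.sum_univ_two, mul_comm]

theorem norm_sq_eq (v : Plane) : ‖v‖ ^ 2 = v 0 ^ 2 + v 1 ^ 2 := by
  simp [EuclideanSpace.norm_sq_eq, Fin.sum_univ_two]

@[simp] theorem norm_rot (v : Plane) : ‖rot v‖ = ‖v‖ := by
  have : ‖rot v‖ ^ 2 = ‖v‖ ^ 2 := by
    rw [norm_sq_eq, norm_sq_eq]; simp; ring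
  exact (sq_eq_sq₀ (norm_nonneg _) (norm_nonneg _)).1 this

@[simp] theorem e_apply (i j : Fin 2) : e i j = if j = i then 1 else 0 := by
  simp [e]

theorem eq_smul_e (v : Plane) : v = v 0 • e 0 + v 1 • e 1 := by
  ext i; fin_cases i <;> simp

/-- The area form of the plane, `crossL v w = v₀ w₁ - v₁ w₀`. The differential of the stream
function of `u` is `crossL u`. -/
def crossL : Plane →L[ℝ] Plane →L[ℝ] ℝ :=
  (EuclideanSpace.proj 0 : Plane →L[ℝ] ℝ).smulRight (EuclideanSpace.proj 1 : Plane →L[ℝ] ℝ) -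
    (EuclideanSpace.proj 1 : Plane →L[ℝ] ℝ).smulRight (EuclideanSpace.proj 0 : Plane →L[ℝ] ℝ)

@[simp] theorem crossL_apply (v w : Plane) : crossL v w = v 0 * w 1 - v 1 * w 0 := by
  simp [crossL]

theorem crossL_eq_inner (v w : Plane) : crossL v w = inner ℝ (rot v) w := by
  rw [inner_eq]; simp; ring

theorem norm_crossL_le (v : Plane) : ‖crossL v‖ ≤ ‖v‖ := by
  refine ContinuousLinearMap.opNorm_le_bound _ (norm_nonneg _) fun w => ?_
  rw [crossL_eq_inner, ← norm_rot v]
  exact norm_inner_le_norm _ _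

theorem crossL_eq_zero {v : Plane} (h : crossL v = 0) : v = 0 := by
  have h0 := DFunLike.congr_fun h (e 0)
  have h1 := DFunLike.congr_fun h (e 1)
  simp at h0 h1
  ext i; fin_cases i <;> simp [h0, h1]

/-- A linear form that vanishes on `v ≠ 0` is a multiple of `crossL v`. -/
theorem eq_smul_crossL {v : Plane} (hv : v ≠ 0) (φ : Plane →L[ℝ] ℝ) (h : φ v = 0) :
    φ = (φ (rot v) / ‖v‖ ^ 2) • crossL v := by
  have hn : ‖v‖ ^ 2 ≠ 0 := by simpa using hv
  ext w
  have h1 : ‖v‖ ^ 2 • w = (v 0 * w 0 + v 1 * w 1) • v + (crossL v w) • rot v := by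
    rw [norm_sq_eq]
    ext i; fin_cases i <;> simp <;> ring
  have h2 := congrArg φ h1
  simp only [map_add, map_smul, h, smul_eq_mul, mul_zero, zero_add] at h2
  simp only [smul_apply, smul_eq_mul]
  field_simp
  linarith

/-! ### Stream functions -/

/-- `Ψ` is a stream function of `u` in `Ω`, up to a constant: its differential is `crossL u`. -/
def HasStream (Ω : Set Plane) (u : Plane → Plane) (Ψ : Plane → ℝ) : Prop :=
  ∀ x ∈ Ω, HasFDerivAt Ψ (crossL (u x)) x

theorem IsStreamFunction.hasStream {Ω : Set Plane} (hΩ : IsOpen Ω) {u : Plane → Plane}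
    {ψ : Plane → ℝ} (h : IsStreamFunction Ω u ψ) : HasStream Ω u ψ := by
  intro x hx
  have hd : DifferentiableAt ℝ ψ x := h.differentiableOn.differentiableAt (hΩ.mem_nhds hx)
  refine hd.hasGradientAt.hasFDerivAt.congr_fderiv ?_
  ext w
  rw [h.velocity_eq x hx, InnerProductSpace.toDual_apply_apply, inner_eq]
  simp; ring

theorem HasStream.contDiffOn {Ω : Set Plane} (hΩ : IsOpen Ω) {u : Plane → Plane} {Ψ : Plane → ℝ}
    (h : HasStream Ω u Ψ) {n : ℕ} (hu : ContDiffOn ℝ n u Ω) : ContDiffOn ℝ (n + 1) Ψ Ω := by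
  rw [contDiffOn_succ_iff_fderiv_of_isOpen hΩ]
  refine ⟨fun x hx => (h x hx).differentiableAt.differentiableWithinAt, by simp, ?_⟩
  exact (crossL.contDiff.comp_contDiffOn hu).congr fun x hx => (h x hx).fderiv

/-! ### Steady Euler flows -/

theorem hasFDerivAt_fderiv_apply {Ω : Set Plane} (hΩ : IsOpen Ω) {u : Plane → Plane}
    (hu : ContDiffOn ℝ 2 u Ω) {x : Plane} (hx : x ∈ Ω) :
    HasFDerivAt (fderiv ℝ u) (fderiv ℝ (fderiv ℝ u) x) x := by
  have h : ContDiffAt ℝ 2 u x := hu.contDiffAt (hΩ.mem_nhds hx)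
  exact ((h.fderiv_right (m := 1) (by norm_num)).differentiableAt (by norm_num)).hasFDerivAt

theorem contDiffOn_fderiv {Ω : Set Plane} (hΩ : IsOpen Ω) {u : Plane → Plane}
    (hu : ContDiffOn ℝ 2 u Ω) : ContDiffOn ℝ 1 (fderiv ℝ u) Ω :=
  ((contDiffOn_succ_iff_fderiv_of_isOpen (n := 1) hΩ).1 hu).2.2

theorem hasFDerivAt_coord {f : Plane → Plane →L[ℝ] Plane} {f' : Plane →L[ℝ] Plane →L[ℝ] Plane}
    {x : Plane} (h : HasFDerivAt f f' x) (v : Plane) (i : Fin 2) :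
    HasFDerivAt (fun y => f y v i)
      ((EuclideanSpace.proj i : Plane →L[ℝ] ℝ).comp (f'.flip v)) x := by
  have h1 : HasFDerivAt (fun y => f y v) (f'.flip v) x :=
    (ContinuousLinearMap.apply ℝ Plane v).hasFDerivAt.comp x h
  exact (EuclideanSpace.proj i : Plane →L[ℝ] ℝ).hasFDerivAt.comp x h1

theorem fderiv_symm {Ω : Set Plane} (hΩ : IsOpen Ω) {u : Plane → Plane}
    (hu : ContDiffOn ℝ 2 u Ω) {x : Plane} (hx : x ∈ Ω) (v w : Plane) :
    fderiv ℝ (fderiv ℝ u) x v w = fderiv ℝ (fderiv ℝ u) x w v := by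
  refine second_derivative_symmetric_of_eventually (f := u) ?_ (hasFDerivAt_fderiv_apply hΩ hu hx)
    v w
  filter_upwards [hΩ.mem_nhds hx] with y hy
  exact ((hu.contDiffAt (hΩ.mem_nhds hy)).differentiableAt (by norm_num)).hasFDerivAt

theorem contDiffOn_vorticity {Ω : Set Plane} (hΩ : IsOpen Ω) {u : Plane → Plane}
    (hu : ContDiffOn ℝ 2 u Ω) : ContDiffOn ℝ 1 (vorticity u) Ω := by
  have h := contDiffOn_fderiv hΩ hu
  have key : ∀ (v : Plane) (i : Fin 2), ContDiffOn ℝ 1 (fun y => fderiv ℝ u y v i) Ω := by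
    intro v i
    exact (EuclideanSpace.proj i : Plane →L[ℝ] ℝ).contDiff.comp_contDiffOn
      (h.clm_apply contDiffOn_const)
  exact (key (e 0) 1).sub (key (e 1) 0)

theorem fderiv_vorticity {Ω : Set Plane} (hΩ : IsOpen Ω) {u : Plane → Plane}
    (hu : ContDiffOn ℝ 2 u Ω) {x : Plane} (hx : x ∈ Ω) (v : Plane) :
    fderiv ℝ (vorticity u) x v =
      fderiv ℝ (fderiv ℝ u) x v (e 0) 1 - fderiv ℝ (fderiv ℝ u) x v (e 1) 0 := by
  have h := hasFDerivAt_fderiv_apply hΩ hu hx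
  have := ((hasFDerivAt_coord h (e 0) 1).sub (hasFDerivAt_coord h (e 1) 0)).fderiv
  have h2 : fderiv ℝ (vorticity u) x = _ := this
  rw [h2]; simp

theorem fderiv_divergence_eq_zero {Ω : Set Plane} (hΩ : IsOpen Ω) {u : Plane → Plane}
    (hu : ContDiffOn ℝ 2 u Ω) (hdiv : ∀ x ∈ Ω, divergence u x = 0) {x : Plane} (hx : x ∈ Ω)
    (v : Plane) :
    fderiv ℝ (fderiv ℝ u) x v (e 0) 0 + fderiv ℝ (fderiv ℝ u) x v (e 1) 1 = 0 := by
  have h := hasFDerivAt_fderiv_apply hΩ hu hx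
  have h1 := (hasFDerivAt_coord h (e 0) 0).add (hasFDerivAt_coord h (e 1) 1)
  have h2 : HasFDerivAt (divergence u) (0 : Plane →L[ℝ] ℝ) x := by
    refine (hasFDerivAt_const (0 : ℝ) x).congr_of_eventuallyEq ?_
    filter_upwards [hΩ.mem_nhds hx] with y hy using hdiv y hy
  have h3 := DFunLike.congr_fun (h1.unique h2) v
  simpa using h3

theorem laplacian_apply (u : Plane → Plane) (x : Plane) :
    Δ u x = fderiv ℝ (fderiv ℝ u) x (e 0) (e 0) + fderiv ℝ (fderiv ℝ u) x (e 1) (e 1) := by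
  rw [InnerProductSpace.laplacian_eq_iteratedFDeriv_orthonormalBasis u
    (EuclideanSpace.basisFun (Fin 2) ℝ)]
  simp [Fin.sum_univ_two, iteratedFDeriv_two_apply, e]

/-- For a divergence free field, `Δ u = rot (∇ ω)`; paired with `u` this is minus the derivative
of the vorticity across the streamlines. -/
theorem inner_laplacian {Ω : Set Plane} (hΩ : IsOpen Ω) {u : Plane → Plane}
    (hu : ContDiffOn ℝ 2 u Ω) (hdiv : ∀ x ∈ Ω, divergence u x = 0) {x : Plane} (hx : x ∈ Ω) :
    inner ℝ (u x) (Δ u x) = -fderiv ℝ (vorticity u) x (rot (u x)) := by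
  have hr : rot (u x) = (-u x 1) • e 0 + u x 0 • e 1 := by
    ext i; fin_cases i <;> simp
  rw [hr, map_add, map_smul, map_smul, fderiv_vorticity hΩ hu hx, fderiv_vorticity hΩ hu hx,
    laplacian_apply, inner_eq]
  have d0 := fderiv_divergence_eq_zero hΩ hu hdiv hx (e 0)
  have d1 := fderiv_divergence_eq_zero hΩ hu hdiv hx (e 1)
  have s := fderiv_symm hΩ hu hx (e 0) (e 1)
  rw [s] at d0
  simp only [PiLp.add_apply, smul_eq_mul, s]
  linear_combination (u x 0) * d0 + (u x 1) * d1

/-- The vorticity of a steady planar Euler flow is transported: `u · ∇ ω = 0`. The pressure is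
only assumed `C¹`; the momentum equation makes it `C²`, so that the curl of its gradient
vanishes. -/
theorem fderiv_vorticity_velocity {Ω : Set Plane} (hΩ : IsOpen Ω) {u : Plane → Plane}
    {p : Plane → ℝ} (hu : ContDiffOn ℝ 2 u Ω) (hp : ContDiffOn ℝ 1 p Ω)
    (hmom : ∀ x ∈ Ω, convection u x + ∇ p x = 0) (hdiv : ∀ x ∈ Ω, divergence u x = 0)
    {x : Plane} (hx : x ∈ Ω) : fderiv ℝ (vorticity u) x (u x) = 0 := by
  set D2 := fderiv ℝ (fderiv ℝ u) x with hD2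
  set A := fderiv ℝ u x with hA
  have hud : HasFDerivAt u A x :=
    ((hu.contDiffAt (hΩ.mem_nhds hx)).differentiableAt (by norm_num)).hasFDerivAt
  have hconv : HasFDerivAt (convection u) (A.comp A + D2.flip (u x)) x :=
    (hasFDerivAt_fderiv_apply hΩ hu hx).clm_apply hud
  have hp' : ∀ᶠ y in 𝓝 x, HasFDerivAt p (-(innerSL ℝ (convection u y))) y := by
    filter_upwards [hΩ.mem_nhds hx] with y hy
    have hd : DifferentiableAt ℝ p y :=
      (hp.contDiffAt (hΩ.mem_nhds hy)).differentiableAt (by norm_num)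
    refine hd.hasGradientAt.hasFDerivAt.congr_fderiv ?_
    have h1 : ∇ p y = -convection u y := eq_neg_of_add_eq_zero_right (hmom y hy)
    rw [h1]; ext w; simp
  have hp'' : HasFDerivAt (fun y => -(innerSL ℝ (convection u y)))
      (-((innerSL ℝ : Plane →L[ℝ] Plane →L[ℝ] ℝ).comp (A.comp A + D2.flip (u x)))) x :=
    ((innerSL ℝ : Plane →L[ℝ] Plane →L[ℝ] ℝ).hasFDerivAt.comp x hconv).neg
  have hs := second_derivative_symmetric_of_eventually hp' hp'' (e 0) (e 1)
  simp only [neg_apply, ContinuousLinearMap.comp_apply,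
    add_apply, innerSL_apply_apply, inner_eq, ContinuousLinearMap.flip_apply,
    PiLp.add_apply] at hs
  simp only [e_apply] at hs
  have hd : A (e 0) 0 + A (e 1) 1 = 0 := hdiv x hx
  have a0 : ∀ i, A (A (e 0)) i = A (e 0) 0 * A (e 0) i + A (e 0) 1 * A (e 1) i := by
    intro i
    conv_lhs => rw [eq_smul_e (A (e 0))]
    simp
  have a1 : ∀ i, A (A (e 1)) i = A (e 1) 0 * A (e 0) i + A (e 1) 1 * A (e 1) i := by
    intro i
    conv_lhs => rw [eq_smul_e (A (e 1))]
    simp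
  rw [fderiv_vorticity hΩ hu hx, ← hD2, fderiv_symm hΩ hu hx (u x), fderiv_symm hΩ hu hx (u x),
    ← hD2]
  simp only [a0, a1] at hs
  norm_num at hs
  linear_combination -hs - (A (e 0) 1 - A (e 1) 0) * hd

/-! ### The energy identity on streamlines -/

theorem integrable_fderiv_apply {f : Plane → ℝ} (hf : ContDiff ℝ 1 f) (hc : HasCompactSupport f)
    (v : Plane) : Integrable (fun x => fderiv ℝ f x v) :=
  ((hf.continuous_fderiv (by norm_num)).clm_apply continuous_const).integrable_of_hasCompactSupport
    ((hc.fderiv (𝕜 := ℝ)).comp_left (g := fun A : Plane →L[ℝ] ℝ => A v) rfl)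

theorem integral_fderiv_eq_zero {f : Plane → ℝ} (hf : ContDiff ℝ 1 f) (hc : HasCompactSupport f)
    (v : Plane) : ∫ x, fderiv ℝ f x v = 0 := by
  have := integral_mul_fderiv_eq_neg_fderiv_mul_of_integrable (𝕜 := ℝ) (μ := volume)
    (f := fun _ : Plane => (1 : ℝ)) (g := f) (v := v) (by simp)
    (by simpa using integrable_fderiv_apply hf hc v)
    (by simpa using hf.continuous.integrable_of_hasCompactSupport hc)
    (fun x _ => differentiableAt_const _)
    (fun x _ => (hf.differentiable (by norm_num)) x)
  simpa using this

theorem fderiv_coord {F : Plane → Plane} {x : Plane} (hF : DifferentiableAt ℝ F x) (v : Plane)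
    (i : Fin 2) : fderiv ℝ (fun y => F y i) x v = fderiv ℝ F x v i := by
  have h : HasFDerivAt (fun y => F y i)
      ((EuclideanSpace.proj i : Plane →L[ℝ] ℝ).comp (fderiv ℝ F x)) x :=
    (EuclideanSpace.proj i : Plane →L[ℝ] ℝ).hasFDerivAt.comp x hF.hasFDerivAt
  rw [h.fderiv]; simp

theorem integral_divergence_eq_zero {F : Plane → Plane} (hF : ContDiff ℝ 1 F)
    (hc : HasCompactSupport F) : ∫ x, divergence F x = 0 := by
  have hF' : ∀ i, ContDiff ℝ 1 (fun y => F y i) := fun i =>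
    (EuclideanSpace.proj i : Plane →L[ℝ] ℝ).contDiff.comp hF
  have hc' : ∀ i, HasCompactSupport (fun y => F y i) := fun i =>
    hc.comp_left (g := fun v : Plane => v i) rfl
  have h : ∀ x, divergence F x =
      fderiv ℝ (fun y => F y 0) x (e 0) + fderiv ℝ (fun y => F y 1) x (e 1) := fun x => by
    have := (hF.differentiable (by norm_num)) x
    rw [fderiv_coord this, fderiv_coord this, divergence]
  simp_rw [h]
  rw [integral_add (integrable_fderiv_apply (hF' 0) (hc' 0) _)
    (integrable_fderiv_apply (hF' 1) (hc' 1) _),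
    integral_fderiv_eq_zero (hF' 0) (hc' 0), integral_fderiv_eq_zero (hF' 1) (hc' 1), add_zero]

theorem divergence_smul {m : Plane → ℝ} {u : Plane → Plane} {x : Plane}
    (hm : DifferentiableAt ℝ m x) (hu : DifferentiableAt ℝ u x) :
    divergence (fun y => m y • u y) x = fderiv ℝ m x (u x) + m x * divergence u x := by
  rw [divergence, fderiv_fun_smul hm hu]
  simp only [add_apply, smul_apply, ContinuousLinearMap.smulRight_apply, PiLp.add_apply,
    PiLp.smul_apply, smul_eq_mul]
  have : fderiv ℝ m x (u x) = u x 0 * fderiv ℝ m x (e 0) + u x 1 * fderiv ℝ m x (e 1) := by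
    conv_lhs => rw [eq_smul_e (u x)]
    simp
  rw [this, divergence]; ring

/-- A steady Navier-Stokes flow does no viscous work on its streamlines: testing the momentum
equation against `χ η(φ) u`, where `φ` is the stream function and the cutoff `χ` is locally
constant wherever `η(φ) ≠ 0`, kills the transport and the pressure, since these form the
derivative of the Bernoulli function `|u|² / 2 + p` along `u`. -/
theorem integral_inner_laplacian_eq_zero {Ω : Set Plane} (hΩ : IsOpen Ω) {u : Plane → Plane}
    {p φ : Plane → ℝ} {ε : ℝ} (hε : ε ≠ 0) (hu : ContDiffOn ℝ 2 u Ω) (hp : ContDiffOn ℝ 1 p Ω)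
    (hmom : ∀ x ∈ Ω, convection u x + ∇ p x - ε ^ 2 • Δ u x = 0)
    (hdiv : ∀ x ∈ Ω, divergence u x = 0) (hφ : HasStream Ω u φ) {χ : Plane → ℝ}
    (hχ : ContDiff ℝ 1 χ) (hχc : HasCompactSupport χ) (hχΩ : tsupport χ ⊆ Ω) {η : ℝ → ℝ}
    (hη : ContDiff ℝ 1 η) (hloc : ∀ x ∈ tsupport χ, η (φ x) ≠ 0 → fderiv ℝ χ x = 0) :
    ∫ x, χ x * η (φ x) * inner ℝ (u x) (Δ u x) = 0 := by
  have hφ1 : ContDiffOn ℝ 1 φ Ω :=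
    (hφ.contDiffOn hΩ (n := 2) (by exact_mod_cast hu)).of_le (by norm_num)
  have hu1 : ContDiffOn ℝ 1 u Ω := hu.of_le (by norm_num)
  set B : Plane → ℝ := fun x => (1 / 2) * inner ℝ (u x) (u x) + p x with hB
  set M : Plane → ℝ := fun x => χ x * (η (φ x) * B x) with hM
  have hBc : ContDiffOn ℝ 1 B Ω := (contDiffOn_const.mul (hu1.inner ℝ hu1)).add hp
  have hMc : ∀ x ∈ Ω, ContDiffAt ℝ 1 M x := fun x hx =>
    hχ.contDiffAt.mul ((hη.contDiffAt.comp x (hφ1.contDiffAt (hΩ.mem_nhds hx))).mul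
      (hBc.contDiffAt (hΩ.mem_nhds hx)))
  have hsupp : ∀ x, x ∉ tsupport χ → (fun y => M y • u y) =ᶠ[𝓝 x] fun _ => 0 := by
    intro x hx
    filter_upwards [(isClosed_tsupport χ).isOpen_compl.mem_nhds hx] with y hy
    simp [hM, image_eq_zero_of_notMem_tsupport hy]
  have hF : ContDiff ℝ 1 (fun y => M y • u y) := by
    rw [contDiff_iff_contDiffAt]
    intro x
    by_cases hx : x ∈ tsupport χ
    · exact (hMc x (hχΩ hx)).smul (hu1.contDiffAt (hΩ.mem_nhds (hχΩ hx)))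
    · exact contDiffAt_const.congr_of_eventuallyEq (hsupp x hx)
  have hFc : HasCompactSupport (fun y => M y • u y) := by
    refine HasCompactSupport.of_support_subset_isCompact hχc fun x hx => ?_
    by_contra h
    exact hx (hsupp x h).self_of_nhds
  have key : ∀ x, divergence (fun y => M y • u y) x =
      ε ^ 2 * (χ x * η (φ x) * inner ℝ (u x) (Δ u x)) := by
    intro x
    by_cases hx : x ∈ tsupport χ
    · have hxΩ := hχΩ hx
      have hud : DifferentiableAt ℝ u x :=
        (hu1.contDiffAt (hΩ.mem_nhds hxΩ)).differentiableAt (by norm_num)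
      have hpd : DifferentiableAt ℝ p x :=
        (hp.contDiffAt (hΩ.mem_nhds hxΩ)).differentiableAt (by norm_num)
      rw [divergence_smul ((hMc x hxΩ).differentiableAt (by norm_num)) hud, hdiv x hxΩ, mul_zero,
        add_zero]
      have h1 : HasFDerivAt (fun y => η (φ y)) (deriv η (φ x) • crossL (u x)) x :=
        ((hη.differentiable (by norm_num)) (φ x)).hasDerivAt.comp_hasFDerivAt x (hφ x hxΩ)
      have h2 := ((hud.hasFDerivAt.inner ℝ hud.hasFDerivAt).const_mul (1 / 2)).add hpd.hasFDerivAt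
      have h3 := ((hχ.differentiable (by norm_num)) x).hasFDerivAt.mul (h1.mul h2)
      have h4 : fderiv ℝ M x = _ := h3.fderiv
      have h5 : fderiv ℝ p x (u x) = inner ℝ (∇ p x) (u x) := by
        rw [hpd.hasGradientAt.hasFDerivAt.fderiv, InnerProductSpace.toDual_apply_apply]
      have h6 : fderiv ℝ u x (u x) = ε ^ 2 • Δ u x - ∇ p x := by
        have := hmom x hxΩ
        rw [convection] at this
        rw [← sub_eq_zero, ← this]; abel
      have h7 : fderiv ℝ χ x (u x) * η (φ x) = 0 := by
        by_cases h : η (φ x) = 0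
        · rw [h, mul_zero]
        · rw [hloc x hx h]; simp
      have h8 : crossL (u x) (u x) = 0 := by simp; ring
      rw [h4]
      simp only [add_apply, smul_apply, ContinuousLinearMap.comp_apply, fderivInnerCLM_apply,
        ContinuousLinearMap.prod_apply, smul_eq_mul, h8, h5, h6, inner_sub_right, inner_sub_left,
        inner_smul_left, inner_smul_right, real_inner_comm (u x) (∇ p x),
        real_inner_comm (u x) (Δ u x)]
      simp only [RCLike.conj_to_real, Pi.mul_apply, Pi.add_apply]
      linear_combination (1 / 2 * inner ℝ (u x) (u x) + p x) * h7
    · have h1 := (hsupp x hx).fderiv_eq (𝕜 := ℝ)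
      rw [divergence, h1, image_eq_zero_of_notMem_tsupport hx]
      simp
  have h := integral_divergence_eq_zero hF hFc
  simp_rw [key] at h
  rw [integral_const_mul] at h
  exact (mul_eq_zero.1 h).resolve_left (pow_ne_zero _ hε)

/-! ### Passage to the limit -/

theorem continuous_mul_of_tsupport_subset {Ω : Set Plane} (hΩ : IsOpen Ω) {χ h : Plane → ℝ}
    (hχ : Continuous χ) (hχΩ : tsupport χ ⊆ Ω) (hh : ContinuousOn h Ω) :
    Continuous fun x => χ x * h x := by
  refine continuous_of_tsupport fun x hx => ?_
  have hx' : x ∈ tsupport χ := tsupport_mul_subset_left hx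
  exact hχ.continuousAt.mul (hh.continuousAt (hΩ.mem_nhds (hχΩ hx')))

theorem continuousOn_laplacian {Ω : Set Plane} (hΩ : IsOpen Ω) {u : Plane → Plane}
    (hu : ContDiffOn ℝ 2 u Ω) : ContinuousOn (Δ u) Ω := by
  have h : ContinuousOn (fun x => fderiv ℝ (fderiv ℝ u) x) Ω :=
    (contDiffOn_fderiv hΩ hu).continuousOn_fderiv_of_isOpen hΩ (by norm_num)
  refine ContinuousOn.congr ?_ fun x _ => laplacian_apply u x
  exact ((h.clm_apply continuousOn_const).clm_apply continuousOn_const).add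
    ((h.clm_apply continuousOn_const).clm_apply continuousOn_const)

theorem tendsto_integral_inner_laplacian {Ω : Set Plane} (hΩ : IsOpen Ω) {u : ℕ → Plane → Plane}
    {v : Plane → Plane} {φ : ℕ → Plane → ℝ} {Ψ : Plane → ℝ} {χ : Plane → ℝ} {η : ℝ → ℝ}
    (hu : ∀ n, ContDiffOn ℝ 2 (u n) Ω) (hv : ContDiffOn ℝ 2 v Ω)
    (hφ : ∀ n, ContinuousOn (φ n) Ω)
    (hχ : Continuous χ) (hχc : HasCompactSupport χ) (hχΩ : tsupport χ ⊆ Ω)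
    (hη : Continuous η) (hη1 : ∀ t, |η t| ≤ 1)
    (hu_lim : TendstoUniformlyOn u v atTop (tsupport χ))
    (hlap_lim : TendstoUniformlyOn (fun n => Δ (u n)) (Δ v) atTop (tsupport χ))
    (hφ_lim : TendstoUniformlyOn φ Ψ atTop (tsupport χ)) :
    Tendsto (fun n => ∫ x, χ x * η (φ n x) * inner ℝ (u n x) (Δ (u n) x)) atTop
      (𝓝 (∫ x, χ x * η (Ψ x) * inner ℝ (v x) (Δ v x))) := by
  have hK : IsCompact (tsupport χ) := hχc
  obtain ⟨C1, hC1⟩ := hK.exists_bound_of_continuousOn (hv.continuousOn.mono hχΩ)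
  obtain ⟨C2, hC2⟩ := hK.exists_bound_of_continuousOn ((continuousOn_laplacian hΩ hv).mono hχΩ)
  have bd : ∀ {f : ℕ → Plane → Plane} {g : Plane → Plane} {C : ℝ},
      TendstoUniformlyOn f g atTop (tsupport χ) → (∀ x ∈ tsupport χ, ‖g x‖ ≤ C) →
      ∀ᶠ n in atTop, ∀ x ∈ tsupport χ, ‖f n x‖ ≤ C + 1 := by
    intro f g C hfg hg
    filter_upwards [Metric.tendstoUniformlyOn_iff.1 hfg 1 one_pos] with n hn x hx
    have h1 := hn x hx
    rw [dist_comm, dist_eq_norm] at h1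
    have := norm_le_norm_add_norm_sub' (f n x) (g x)
    linarith [hg x hx]
  refine tendsto_integral_filter_of_dominated_convergence
    (fun x => ‖χ x‖ * ((C1 + 1) * (C2 + 1))) ?_ ?_ ?_ ?_
  · refine Eventually.of_forall fun n => Continuous.aestronglyMeasurable ?_
    simp_rw [mul_assoc]
    exact continuous_mul_of_tsupport_subset hΩ hχ hχΩ ((hη.comp_continuousOn (hφ n)).mul
      ((hu n).continuousOn.inner (continuousOn_laplacian hΩ (hu n))))
  · filter_upwards [bd hu_lim hC1, bd hlap_lim hC2] with n h1 h2
    refine Eventually.of_forall fun x => ?_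
    by_cases hx : x ∈ tsupport χ
    · have h3 : ‖inner ℝ (u n x) (Δ (u n) x)‖ ≤ (C1 + 1) * (C2 + 1) :=
        (norm_inner_le_norm _ _).trans (mul_le_mul (h1 x hx) (h2 x hx) (norm_nonneg _)
          ((norm_nonneg _).trans (h1 x hx)))
      rw [norm_mul, norm_mul, mul_assoc]
      refine mul_le_mul_of_nonneg_left ?_ (norm_nonneg _)
      calc ‖η (φ n x)‖ * ‖inner ℝ (u n x) (Δ (u n) x)‖
          ≤ 1 * ‖inner ℝ (u n x) (Δ (u n) x)‖ :=
            mul_le_mul_of_nonneg_right (hη1 _) (norm_nonneg _)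
        _ ≤ _ := by rw [one_mul]; exact h3
    · simp [image_eq_zero_of_notMem_tsupport hx]
  · exact (hχ.norm.mul continuous_const).integrable_of_hasCompactSupport
      (hχc.norm.mul_right)
  · refine Eventually.of_forall fun x => ?_
    by_cases hx : x ∈ tsupport χ
    · exact (tendsto_const_nhds.mul ((hη.tendsto _).comp (hφ_lim.tendsto_at hx))).mul
        ((hu_lim.tendsto_at hx).inner (hlap_lim.tendsto_at hx))
    · simp [image_eq_zero_of_notMem_tsupport hx]

/-- Stream functions of a locally uniformly convergent sequence of fields converge locally
uniformly, once normalized by constants, to a stream function of the limit. -/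
theorem exists_hasStream_limit {Ω : Set Plane} (hΩ : IsOpen Ω) (hpre : IsPreconnected Ω)
    (hne : Ω.Nonempty) {u : ℕ → Plane → Plane} {v : Plane → Plane} {φ : ℕ → Plane → ℝ}
    (hφ : ∀ n, HasStream Ω (u n) (φ n))
    (hu : ∀ K ⊆ Ω, IsCompact K → TendstoUniformlyOn u v atTop K) :
    ∃ Ψ : Plane → ℝ, HasStream Ω v Ψ ∧ ∃ c : ℕ → ℝ, ∀ K ⊆ Ω, IsCompact K →
      TendstoUniformlyOn (fun n x => φ n x - c n) Ψ atTop K := by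
  obtain ⟨x₀, hx₀⟩ := hne
  set f : ℕ → Plane → ℝ := fun n x => φ n x - φ n x₀ with hf
  have hfd : ∀ n, ∀ y ∈ Ω, HasFDerivAt (f n) (crossL (u n y)) y := fun n y hy =>
    (hφ n y hy).sub_const _
  have hfu : ∀ K ⊆ Ω, IsCompact K →
      TendstoUniformlyOn (fun n y => crossL (u n y)) (fun y => crossL (v y)) atTop K :=
    fun K hK hKc => crossL.uniformContinuous.comp_tendstoUniformlyOn (hu K hK hKc)
  have hball : ∀ x ∈ Ω, ∃ r > 0, Metric.ball x r ⊆ Ω ∧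
      TendstoUniformlyOn (fun n y => crossL (u n y)) (fun y => crossL (v y)) atTop
        (Metric.ball x r) := by
    intro x hx
    obtain ⟨r, hr, hrΩ⟩ := Metric.nhds_basis_closedBall.mem_iff.1 (hΩ.mem_nhds hx)
    exact ⟨r, hr, Metric.ball_subset_closedBall.trans hrΩ,
      (hfu _ hrΩ (isCompact_closedBall x r)).mono Metric.ball_subset_closedBall⟩
  have hstep : ∀ x ∈ Ω, ∃ r > 0, Metric.ball x r ⊆ Ω ∧ ∀ y ∈ Metric.ball x r,
      ∀ z ∈ Metric.ball x r, Cauchy (map (fun n => f n y) atTop) →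
        Cauchy (map (fun n => f n z) atTop) := by
    intro x hx
    obtain ⟨r, hr, hrΩ, hunif⟩ := hball x hx
    exact ⟨r, hr, hrΩ, fun y hy z hz h => cauchy_map_of_uniformCauchySeqOn_fderiv
      Metric.isOpen_ball (convex_ball x r).isPreconnected hunif.uniformCauchySeqOn
      (fun n w hw => hfd n w (hrΩ hw)) hy hz h⟩
  have hC : ∀ x ∈ Ω, Cauchy (map (fun n => f n x) atTop) := by
    set T : Set Plane := {x | x ∈ Ω ∧ Cauchy (map (fun n => f n x) atTop)}
    have h0 : Cauchy (map (fun n => f n x₀) atTop) := by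
      have : (fun n => f n x₀) = fun _ => 0 := by funext n; simp [hf]
      rw [this]
      exact (tendsto_const_nhds (x := (0 : ℝ))).cauchy_map
    have hsub : Ω ⊆ T := by
      refine hpre.subset_of_closure_inter_subset ?_ ⟨x₀, hx₀, hx₀, h0⟩ ?_
      · rw [Metric.isOpen_iff]
        rintro x ⟨hx, hxC⟩
        obtain ⟨r, hr, hrΩ, h⟩ := hstep x hx
        exact ⟨r, hr, fun y hy => ⟨hrΩ hy, h x (Metric.mem_ball_self hr) y hy hxC⟩⟩
      · rintro x ⟨hxT, hx⟩
        obtain ⟨r, hr, hrΩ, h⟩ := hstep x hx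
        obtain ⟨y, hyT, hy⟩ := Metric.mem_closure_iff.1 hxT r hr
        exact ⟨hx, h y (by rwa [Metric.mem_ball, dist_comm]) x (Metric.mem_ball_self hr) hyT.2⟩
    exact fun x hx => (hsub hx).2
  choose! Ψ hΨ using fun x (hx : x ∈ Ω) => cauchySeq_tendsto_of_complete (hC x hx)
  refine ⟨Ψ, fun x hx => ?_, fun n => φ n x₀, fun K hK hKc => ?_⟩
  · obtain ⟨r, hr, hrΩ, hunif⟩ := hball x hx
    exact hasFDerivAt_of_tendstoUniformlyOn Metric.isOpen_ball hunif
      (fun n w hw => hfd n w (hrΩ hw)) (fun w hw => hΨ w (hrΩ hw)) (Metric.mem_ball_self hr)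
  · refine (tendstoLocallyUniformlyOn_iff_tendstoUniformlyOn_of_compact hKc).1 ?_
    refine TendstoLocallyUniformlyOn.mono (s := Ω) ?_ hK
    refine tendstoLocallyUniformlyOn_of_forall_exists_nhds fun x hx => ?_
    obtain ⟨r, hr, hrΩ, hunif⟩ := hball x hx
    refine ⟨Metric.ball x r, mem_nhdsWithin_of_mem_nhds (Metric.ball_mem_nhds x hr), ?_⟩
    exact (uniformCauchySeqOn_ball_of_fderiv hunif.uniformCauchySeqOn
      (fun n w hw => hfd n w (hrΩ hw)) (hC x hx)).tendstoUniformlyOn_of_tendsto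
      fun w hw => hΨ w (hrΩ hw)

/-! ### Critical values of the stream function are negligible -/

theorem norm_sub_le_pow_succ {E G : Type*} [NormedAddCommGroup E] [NormedSpace ℝ E]
    [NormedAddCommGroup G] [NormedSpace ℝ G] {f : E → G} {f' : E → E →L[ℝ] G} {s : Set E}
    (hs : Convex ℝ s) (hf : ∀ z ∈ s, HasFDerivAt f (f' z) z) {C : ℝ} (hC : 0 ≤ C) {k : ℕ} {x y : E}
    (hx : x ∈ s) (hy : y ∈ s) (hbound : ∀ z ∈ s, ‖f' z‖ ≤ C * ‖z - y‖ ^ k) :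
    ‖f x - f y‖ ≤ C * ‖x - y‖ ^ (k + 1) := by
  have hseg : segment ℝ y x ⊆ s := hs.segment_subset hy hx
  have hz : ∀ z ∈ segment ℝ y x, ‖z - y‖ ≤ ‖x - y‖ := by
    intro z hz
    have := (convex_closedBall y ‖x - y‖).segment_subset (Metric.mem_closedBall_self (norm_nonneg _))
      (by rw [Metric.mem_closedBall, dist_eq_norm] : x ∈ Metric.closedBall y ‖x - y‖) hz
    rwa [Metric.mem_closedBall, dist_eq_norm] at this
  have := (convex_segment (𝕜 := ℝ) y x).norm_image_sub_le_of_norm_hasFDerivWithin_le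
    (C := C * ‖x - y‖ ^ k) (fun z hzs => (hf z (hseg hzs)).hasFDerivWithinAt)
    (fun z hzs => (hbound z (hseg hzs)).trans
      (mul_le_mul_of_nonneg_left (pow_le_pow_left₀ (norm_nonneg _) (hz z hzs) k) hC))
    (left_mem_segment ℝ y x) (right_mem_segment ℝ y x)
  rwa [mul_assoc, ← pow_succ] at this

theorem holderOnWith_of_norm_sub_le {E G : Type*} [NormedAddCommGroup E] [NormedAddCommGroup G]
    {f : E → G} {s : Set E} {C : NNReal} {k : ℕ}
    (h : ∀ x ∈ s, ∀ y ∈ s, ‖f x - f y‖ ≤ C * ‖x - y‖ ^ k) : HolderOnWith C k f s := by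
  intro x hx y hy
  rw [edist_eq_enorm_sub, edist_eq_enorm_sub, NNReal.coe_natCast, ENNReal.rpow_natCast,
    ← ofReal_norm, ← ofReal_norm, ← ENNReal.ofReal_pow (norm_nonneg _),
    ← ENNReal.ofReal_coe_nnreal, ← ENNReal.ofReal_mul C.coe_nonneg]
  exact ENNReal.ofReal_le_ofReal (h x hx y hy)

/-- Near a point where its derivative does not vanish, the zero set of a planar field has
dimension at most one: a linear coordinate is injective on it, with Lipschitz inverse. -/
theorem exists_nhds_dimH_zeros_le_one {u : Plane → Plane} {A : Plane →L[ℝ] Plane} {x : Plane}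
    (hu : HasStrictFDerivAt u A x) (hA : A ≠ 0) :
    ∃ N ∈ 𝓝 x, ∀ T ⊆ N, (∀ y ∈ T, u y = 0) → dimH T ≤ 1 := by
  obtain ⟨w, hw⟩ : ∃ w, A w ≠ 0 := by
    by_contra! h
    exact hA (ContinuousLinearMap.ext h)
  have hw0 : w ≠ 0 := fun h => hw (by simp [h])
  have hwn : 0 < ‖w‖ := norm_pos_iff.2 hw0
  set a := ‖A w‖ with ha
  have ha0 : 0 < a := norm_pos_iff.2 hw
  have hc : 0 < a / (2 * ‖w‖) := by positivity
  obtain ⟨N, hN, hNa⟩ := hu.approximates_deriv_on_nhds (c := ⟨a / (2 * ‖w‖), hc.le⟩)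
    (Or.inr hc)
  refine ⟨N, hN, fun T hTN hT => ?_⟩
  set K : ℝ := (‖A‖ * ‖w‖ + a) * 2 / (a * ‖w‖) with hK
  have hK0 : 0 ≤ K := by positivity
  have key : ∀ y ∈ T, ∀ z ∈ T, ‖y - z‖ ≤ K * ‖crossL w y - crossL w z‖ := by
    intro y hy z hz
    set v := y - z with hv
    have h1 : ‖A v‖ ≤ a / (2 * ‖w‖) * ‖v‖ := by
      have := hNa y (hTN hy) z (hTN hz)
      rw [hT y hy, hT z hz, sub_zero, zero_sub, norm_neg] at this
      exact this
    have h2 : ‖w‖ ^ 2 • v = (inner ℝ w v) • w + (crossL w v) • rot w := by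
      rw [norm_sq_eq, inner_eq]
      ext i; fin_cases i <;> simp <;> ring
    have h3 : ‖w‖ ^ 2 • A v = (inner ℝ w v) • A w + (crossL w v) • A (rot w) := by
      have := congrArg A h2
      simpa only [map_add, map_smul] using this
    have h4 : ‖w‖ * ‖v‖ ≤ |inner ℝ w v| + |crossL w v| := by
      have h := norm_add_le ((inner ℝ w v) • w) ((crossL w v) • rot w)
      rw [← h2, norm_smul, norm_smul, norm_smul, norm_rot, norm_pow, norm_norm, Real.norm_eq_abs,
        Real.norm_eq_abs, ← add_mul] at h
      refine le_of_mul_le_mul_right ?_ hwn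
      linarith
    have h5 : |inner ℝ w v| * a ≤ ‖w‖ ^ 2 * ‖A v‖ + |crossL w v| * (‖A‖ * ‖w‖) := by
      have h : (inner ℝ w v) • A w = ‖w‖ ^ 2 • A v - (crossL w v) • A (rot w) := by
        rw [h3]; abel
      have h' := norm_sub_le (‖w‖ ^ 2 • A v) ((crossL w v) • A (rot w))
      rw [← h, norm_smul, norm_smul, norm_smul, norm_pow, norm_norm, Real.norm_eq_abs,
        Real.norm_eq_abs] at h'
      refine h'.trans (add_le_add_right (mul_le_mul_of_nonneg_left ?_ (abs_nonneg _)) _)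
      simpa using A.le_opNorm (rot w)
    have h6 : ‖w‖ ^ 2 * ‖A v‖ ≤ a * ‖w‖ * ‖v‖ / 2 := by
      calc ‖w‖ ^ 2 * ‖A v‖ ≤ ‖w‖ ^ 2 * (a / (2 * ‖w‖) * ‖v‖) := by gcongr
        _ = a * ‖w‖ * ‖v‖ / 2 := by field_simp
    have h7 : crossL w y - crossL w z = crossL w v := by rw [hv, map_sub]
    rw [h7, hK, Real.norm_eq_abs, div_mul_eq_mul_div, le_div_iff₀ (by positivity)]
    nlinarith
  have hanti : AntilipschitzWith ⟨K, hK0⟩ (fun y : T => crossL w (y : Plane)) := by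
    refine AntilipschitzWith.of_le_mul_dist fun y z => ?_
    rw [Subtype.dist_eq, dist_eq_norm, dist_eq_norm]
    exact key y y.2 z z.2
  have h1 : dimH T = dimH (univ : Set T) := by
    have := (isometry_subtype_coe (s := T)).dimH_image univ
    rwa [image_univ, Subtype.range_coe] at this
  rw [h1]
  refine (hanti.le_dimH_image univ).trans ((dimH_mono (subset_univ _)).trans ?_)
  rw [Real.dimH_univ]

/-- Sard's theorem for the stream function of a `C²` field. On the critical points where the
velocity gradient vanishes, the stream function is Hölder of exponent `3`, so that their image has
dimension at most `2 / 3`. The other critical points form a set of dimension at most one, on which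
the stream function is Hölder of exponent `2`. -/
theorem volume_image_critical_eq_zero {Ω : Set Plane} (hΩ : IsOpen Ω) {u : Plane → Plane}
    {Ψ : Plane → ℝ} (hu : ContDiffOn ℝ 2 u Ω) (hΨ : HasStream Ω u Ψ) :
    volume (Ψ '' {x | x ∈ Ω ∧ u x = 0}) = 0 := by
  have hud : ∀ x ∈ Ω, HasFDerivAt u (fderiv ℝ u x) x := fun x hx =>
    ((hu.contDiffAt (hΩ.mem_nhds hx)).differentiableAt (by norm_num)).hasFDerivAt
  set Z1 : Set Plane := {x | x ∈ Ω ∧ u x = 0 ∧ fderiv ℝ u x ≠ 0} with hZ1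
  set Z2 : Set Plane := {x | x ∈ Ω ∧ u x = 0 ∧ fderiv ℝ u x = 0} with hZ2
  have hnull : ∀ s : Set ℝ, dimH s < 1 → volume s = 0 := by
    intro s hs
    rw [← hausdorffMeasure_real]
    have := hausdorffMeasure_of_dimH_lt (d := 1) (by simpa using hs)
    rwa [NNReal.coe_one] at this
  have hd1 : dimH Z1 ≤ 1 := by
    by_contra! h
    obtain ⟨x, ⟨hxΩ, -, hx⟩, h2⟩ := exists_mem_nhdsWithin_lt_dimH_of_lt_dimH h
    obtain ⟨N, hN, hNd⟩ := exists_nhds_dimH_zeros_le_one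
      ((hu.contDiffAt (hΩ.mem_nhds hxΩ)).hasStrictFDerivAt (by norm_num)) hx
    refine absurd (h2 (Z1 ∩ N) ?_) (not_lt.2 (hNd _ inter_subset_right fun y hy => hy.1.2.1))
    exact inter_mem self_mem_nhdsWithin (mem_nhdsWithin_of_mem_nhds hN)
  have hd2 : dimH Z2 ≤ 2 := by
    refine (dimH_mono (subset_univ _)).trans ?_
    rw [Real.dimH_univ_eq_finrank]; simp
  have h1 : dimH (Ψ '' Z1) ≤ dimH Z1 / ((2 : ℕ) : NNReal) := by
    refine dimH_image_le_of_locally_holder_on (by norm_num) fun x hx => ?_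
    obtain ⟨C, t, ht, hLip⟩ := ((hu.contDiffAt (hΩ.mem_nhds hx.1)).of_le
      (by norm_num : (1 : WithTop ℕ∞) ≤ 2)).exists_lipschitzOnWith
    obtain ⟨r, hr, hrt⟩ := Metric.mem_nhds_iff.1 (inter_mem ht (hΩ.mem_nhds hx.1))
    refine ⟨C, Z1 ∩ Metric.ball x r, inter_mem self_mem_nhdsWithin
      (mem_nhdsWithin_of_mem_nhds (Metric.ball_mem_nhds x hr)),
      holderOnWith_of_norm_sub_le fun y hy z hz => ?_⟩
    refine norm_sub_le_pow_succ (convex_ball x r) (fun w hw => hΨ w (hrt hw).2) C.2 hy.2 hz.2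
      fun w hw => (norm_crossL_le _).trans ?_
    have := hLip.dist_le_mul w (hrt hw).1 z (hrt hz.2).1
    rwa [hz.1.2.1, dist_zero_right, dist_eq_norm, ← pow_one ‖w - z‖] at this
  have h2 : dimH (Ψ '' Z2) ≤ dimH Z2 / ((3 : ℕ) : NNReal) := by
    refine dimH_image_le_of_locally_holder_on (by norm_num) fun x hx => ?_
    obtain ⟨C, t, ht, hLip⟩ :=
      ((contDiffOn_fderiv hΩ hu).contDiffAt (hΩ.mem_nhds hx.1)).exists_lipschitzOnWith
    obtain ⟨r, hr, hrt⟩ := Metric.mem_nhds_iff.1 (inter_mem ht (hΩ.mem_nhds hx.1))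
    refine ⟨C, Z2 ∩ Metric.ball x r, inter_mem self_mem_nhdsWithin
      (mem_nhdsWithin_of_mem_nhds (Metric.ball_mem_nhds x hr)),
      holderOnWith_of_norm_sub_le fun y hy z hz => ?_⟩
    refine norm_sub_le_pow_succ (convex_ball x r) (fun w hw => hΨ w (hrt hw).2) C.2 hy.2 hz.2
      fun w hw => (norm_crossL_le _).trans ?_
    have := norm_sub_le_pow_succ (k := 1) (convex_ball x r) (fun w hw => hud w (hrt hw).2)
      C.2 hw hz.2 fun q hq => ?_
    · rwa [hz.1.2.1, sub_zero] at this
    · have := hLip.dist_le_mul q (hrt hq).1 z (hrt hz.2).1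
      rwa [hz.1.2.2, dist_zero_right, dist_eq_norm, ← pow_one ‖q - z‖] at this
  have hcover : {x | x ∈ Ω ∧ u x = 0} ⊆ Z1 ∪ Z2 := by
    rintro x ⟨hx, h0⟩
    by_cases h : fderiv ℝ u x = 0
    · exact Or.inr ⟨hx, h0, h⟩
    · exact Or.inl ⟨hx, h0, h⟩
  refine measure_mono_null ((image_mono hcover).trans_eq (image_union _ _ _))
    (measure_union_null (hnull _ ?_) (hnull _ ?_))
  · refine (h1.trans (ENNReal.div_le_div_right hd1 _)).trans_lt ?_
    simp
  · refine (h2.trans (ENNReal.div_le_div_right hd2 _)).trans_lt ?_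
    rw [ENNReal.div_lt_iff (by simp) (by simp)]
    norm_num

/-! ### First integrals near a regular point -/

/-- The coordinates of a vector in the orthogonal frame `w, rot w`, up to the factor `‖w‖²`. -/
def frame (w : Plane) (hw : w ≠ 0) : Plane ≃L[ℝ] ℝ × ℝ :=
  LinearEquiv.toContinuousLinearEquiv
    { toFun := fun v => (inner ℝ w v, crossL w v)
      map_add' := fun v v' => by simp [inner_add_right]; ring
      map_smul' := fun c v => by simp [inner_smul_right]
      invFun := fun a => (‖w‖ ^ 2)⁻¹ • (a.1 • w + a.2 • rot w)
      left_inv := fun v => by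
        have hn : w 0 ^ 2 + w 1 ^ 2 ≠ 0 := by rw [← norm_sq_eq]; simpa using hw
        simp only [norm_sq_eq, inner_eq, crossL_apply]
        ext i; fin_cases i <;> simp <;> field_simp <;> ring
      right_inv := fun a => by
        have hn : w 0 ^ 2 + w 1 ^ 2 ≠ 0 := by rw [← norm_sq_eq]; simpa using hw
        simp only [norm_sq_eq, inner_eq, crossL_apply]
        ext <;> simp <;> field_simp <;> ring }

theorem frame_symm_apply (w : Plane) (hw : w ≠ 0) (a : ℝ × ℝ) :
    (frame w hw).symm a = (‖w‖ ^ 2)⁻¹ • (a.1 • w + a.2 • rot w) := rfl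

/-- Near a regular point a first integral `f` of the flow is a function `F(Ψ)` of the stream
function; hence `F'(Ψ)`, the ratio of the derivatives of `f` and `Ψ` across the streamlines, is
constant on level sets of `Ψ`. -/
theorem exists_nhds_ratio_eq {Ω : Set Plane} (hΩ : IsOpen Ω) {u : Plane → Plane} {Ψ f : Plane → ℝ}
    (hu : ContDiffOn ℝ 1 u Ω) (hΨ : HasStream Ω u Ψ) (hf : ContDiffOn ℝ 1 f Ω)
    (hfu : ∀ y ∈ Ω, fderiv ℝ f y (u y) = 0) {x : Plane} (hx : x ∈ Ω) (hux : u x ≠ 0) :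
    ∃ N ∈ 𝓝 x, ∀ y ∈ N, Ψ y = Ψ x →
      fderiv ℝ f y (rot (u y)) / ‖u y‖ ^ 2 = fderiv ℝ f x (rot (u x)) / ‖u x‖ ^ 2 := by
  set q : Plane → ℝ := fun y => fderiv ℝ f y (rot (u y)) / ‖u y‖ ^ 2 with hq
  set Φ : Plane → ℝ × ℝ := fun y => (inner ℝ (u x) y, Ψ y) with hΦ
  have hΨ1 : ContDiffOn ℝ 1 Ψ Ω :=
    (hΨ.contDiffOn hΩ (n := 1) (by exact_mod_cast hu)).of_le (by norm_num)
  have hΦd : ∀ y ∈ Ω, HasFDerivAt Φ ((innerSL ℝ (u x)).prod (crossL (u y))) y := fun y hy =>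
    (innerSL ℝ (u x)).hasFDerivAt.prodMk (hΨ y hy)
  have hΦx : HasFDerivAt Φ (frame (u x) hux : Plane →L[ℝ] ℝ × ℝ) x :=
    (hΦd x hx).congr_fderiv (by ext v <;> rfl)
  have hΦc : ContDiffAt ℝ 1 Φ x :=
    (innerSL ℝ (u x)).contDiff.contDiffAt.prodMk (hΨ1.contDiffAt (hΩ.mem_nhds hx))
  set T := hΦc.localInverse hΦx (by norm_num) with hT
  have hTc : ContDiffAt ℝ 1 T (Φ x) := hΦc.to_localInverse hΦx (by norm_num)
  have hTx : T (Φ x) = x := hΦc.localInverse_apply_image hΦx (by norm_num)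
  have hstrict := hΦc.hasStrictFDerivAt' hΦx (by norm_num)
  have hR : ∀ᶠ a in 𝓝 (Φ x), Φ (T a) = a := hstrict.eventually_right_inverse
  have hL : ∀ᶠ y in 𝓝 x, T (Φ y) = y := hstrict.eventually_left_inverse
  have hTd : ∀ᶠ a in 𝓝 (Φ x), DifferentiableAt ℝ T a := by
    filter_upwards [hTc.eventually (by norm_num)] with a ha
    exact ha.differentiableAt (by norm_num)
  have hreg : ∀ᶠ y in 𝓝 x, y ∈ Ω ∧ u y ≠ 0 :=
    (hΩ.eventually_mem hx).and ((hu.continuousOn.continuousAt (hΩ.mem_nhds hx)).eventually_ne hux)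
  have hTreg : ∀ᶠ a in 𝓝 (Φ x), T a ∈ Ω ∧ u (T a) ≠ 0 := by
    have : Tendsto T (𝓝 (Φ x)) (𝓝 x) := by
      have := hTc.continuousAt.tendsto; rwa [hTx] at this
    exact this.eventually hreg
  obtain ⟨r, hr, hball⟩ := Metric.eventually_nhds_iff_ball.1
    (hR.eventually_nhds.and (hTd.and hTreg))
  set W : ℝ × ℝ → ℝ := fun a => f (T a) with hW
  have hWd : ∀ a ∈ Metric.ball (Φ x) r,
      HasFDerivAt W (q (T a) • ContinuousLinearMap.snd ℝ ℝ ℝ) a := by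
    intro a ha
    obtain ⟨h1, h2, h3, h4⟩ := hball a ha
    have hid : ((innerSL ℝ (u x)).prod (crossL (u (T a)))).comp (fderiv ℝ T a) =
        ContinuousLinearMap.id ℝ (ℝ × ℝ) :=
      ((hΦd _ h3).comp a h2.hasFDerivAt).unique ((hasFDerivAt_id a).congr_of_eventuallyEq h1)
    have hfd : HasFDerivAt f (q (T a) • crossL (u (T a))) (T a) := by
      have := ((hf.contDiffAt (hΩ.mem_nhds h3)).differentiableAt (by norm_num)).hasFDerivAt
      exact this.congr_fderiv (eq_smul_crossL h4 _ (hfu _ h3))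
    refine (hfd.comp a h2.hasFDerivAt).congr_fderiv ?_
    refine ContinuousLinearMap.ext fun h => ?_
    have := congrArg Prod.snd (DFunLike.congr_fun hid h)
    simp only [ContinuousLinearMap.comp_apply, ContinuousLinearMap.prod_apply,
      ContinuousLinearMap.id_apply] at this
    simp only [ContinuousLinearMap.comp_apply, smul_apply, ContinuousLinearMap.coe_snd', this]
  have hWconst : ∀ a b b', (a, b) ∈ Metric.ball (Φ x) r → (b', b) ∈ Metric.ball (Φ x) r →
      W (a, b) = W (b', b) := by
    intro a b b' ha hb'
    rw [show Φ x = ((Φ x).1, (Φ x).2) from rfl, ← ball_prod_same] at ha hb'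
    have hd : ∀ s ∈ Metric.ball (Φ x).1 r, HasDerivAt (fun s => W (s, b)) 0 s := by
      intro s hs
      have hsb : (s, b) ∈ Metric.ball (Φ x) r := by
        rw [show Φ x = ((Φ x).1, (Φ x).2) from rfl, ← ball_prod_same]
        exact ⟨hs, ha.2⟩
      have h := (hWd _ hsb).comp_hasDerivAt s ((hasDerivAt_id s).prodMk (hasDerivAt_const s b))
      exact h.congr_deriv (by simp)
    exact Metric.isOpen_ball.is_const_of_deriv_eq_zero (convex_ball _ _).isPreconnected
      (fun s hs => (hd s hs).differentiableAt.differentiableWithinAt) (fun s hs => (hd s hs).deriv)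
      ha.1 hb'.1
  refine ⟨{y | Φ y ∈ Metric.ball (Φ x) r ∧ T (Φ y) = y}, ?_, ?_⟩
  · exact (hΦc.continuousAt.eventually (Metric.ball_mem_nhds _ hr)).and hL
  · rintro y ⟨hy, hTy⟩ hΨy
    have hq1 : ∀ z, Φ z ∈ Metric.ball (Φ x) r → T (Φ z) = z →
        HasDerivAt (fun s => W ((Φ z).1, s)) (q z) (Φ z).2 := by
      intro z hz hTz
      have h := (hWd _ hz).comp_hasDerivAt (Φ z).2
        ((hasDerivAt_const (Φ z).2 (Φ z).1).prodMk (hasDerivAt_id (Φ z).2))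
      rw [hTz] at h
      exact h.congr_deriv (by simp)
    have h1 := hq1 y hy hTy
    have h2 := hq1 x (Metric.mem_ball_self hr) hTx
    have h3 : (Φ y).2 = (Φ x).2 := hΨy
    rw [h3] at h1
    refine h1.unique (h2.congr_of_eventuallyEq ?_)
    have hy' : ((Φ y).1, (Φ x).2) ∈ Metric.ball (Φ x) r := by rw [← h3]; exact hy
    have e1 : ∀ᶠ s in 𝓝 (Φ x).2, ((Φ y).1, s) ∈ Metric.ball (Φ x) r :=
      (Continuous.prodMk_right (Φ y).1).continuousAt.eventually (Metric.isOpen_ball.mem_nhds hy')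
    have e2 : ∀ᶠ s in 𝓝 (Φ x).2, ((Φ x).1, s) ∈ Metric.ball (Φ x) r :=
      (Continuous.prodMk_right (Φ x).1).continuousAt.eventually (Metric.ball_mem_nhds (Φ x) hr)
    filter_upwards [e1, e2] with s hs1 hs2
    exact hWconst _ _ _ hs1 hs2

/-! ### Boundary values of the stream function -/

theorem IsJordanParam.injOn_Ico {γ : ℝ → Plane} {L : ℝ} (h : IsJordanParam γ L) (s₀ : ℝ) :
    InjOn γ (Ico s₀ (s₀ + L)) := by
  intro a ha b hb hab
  have hmod : ∀ c s, γ (toIcoMod h.length_pos c s) = γ s := fun c s =>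
    h.periodic.sub_zsmul_eq _
  have h0 : toIcoMod h.length_pos 0 a = toIcoMod h.length_pos 0 b := by
    refine h.injOn ?_ ?_ ((hmod 0 a).trans (hab.trans (hmod 0 b).symm))
    · simpa using toIcoMod_mem_Ico h.length_pos 0 a
    · simpa using toIcoMod_mem_Ico h.length_pos 0 b
  have h1 : toIcoMod h.length_pos s₀ a = toIcoMod h.length_pos s₀ b :=
    (toIcoMod_inj h.length_pos).2 ((toIcoMod_inj h.length_pos).1 h0)
  rwa [(toIcoMod_eq_self h.length_pos).2 ha, (toIcoMod_eq_self h.length_pos).2 hb] at h1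

/-- A simple closed curve comes close to `γ s₀` only for parameters close to `s₀`, up to a
period. -/
theorem IsJordanParam.exists_dist_lt {γ : ℝ → Plane} {L : ℝ} (h : IsJordanParam γ L) (s₀ : ℝ)
    {ρ : ℝ} (hρ : 0 < ρ) :
    ∃ d > 0, ∀ s, dist (γ s) (γ s₀) < d → ∃ s', dist s' s₀ < ρ ∧ γ s' = γ s := by
  have hL := h.length_pos
  set K : Set ℝ := Icc s₀ (s₀ + L) \ (Metric.ball s₀ ρ ∪ Metric.ball (s₀ + L) ρ) with hK
  have hKc : IsCompact K :=
    isCompact_Icc.diff (Metric.isOpen_ball.union Metric.isOpen_ball)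
  have hγK : γ s₀ ∉ γ '' K := by
    rintro ⟨t, ⟨ht, htb⟩, hts⟩
    have hne : t ≠ s₀ + L := fun h' => htb (Or.inr (by simpa [h'] using hρ))
    have := h.injOn_Ico s₀ ⟨ht.1, lt_of_le_of_ne ht.2 hne⟩ ⟨le_rfl, by linarith⟩ hts
    exact htb (Or.inl (by simpa [this] using hρ))
  have hcl : IsClosed (γ '' K) := (hKc.image h.contDiff.continuous).isClosed
  obtain ⟨d, hd, hdK⟩ := Metric.isOpen_iff.1 hcl.isOpen_compl _ hγK
  refine ⟨d, hd, fun s hs => ?_⟩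
  set t := toIcoMod hL s₀ s with ht
  have htγ : γ t = γ s := h.periodic.sub_zsmul_eq _
  have htI : t ∈ Ico s₀ (s₀ + L) := toIcoMod_mem_Ico hL s₀ s
  have htK : t ∉ K := fun hmem => hdK (by rwa [Metric.mem_ball]) ⟨t, hmem, htγ⟩
  have : t ∈ Metric.ball s₀ ρ ∪ Metric.ball (s₀ + L) ρ := by
    by_contra hcon
    exact htK ⟨Ico_subset_Icc_self htI, hcon⟩
  rcases this with h1 | h1
  · exact ⟨t, h1, htγ⟩
  · refine ⟨t - L, ?_, by rw [h.periodic.sub_eq, htγ]⟩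
    rw [Metric.mem_ball, Real.dist_eq] at h1
    rw [Real.dist_eq]
    rwa [show t - L - s₀ = t - (s₀ + L) by ring]

/-- On the pushed boundary arcs `s ↦ γ s + k ν` inside `Ω`, the stream function of a field that is
tangent to the boundary becomes constant as `k → 0⁺`: its derivative along the arc is the normal
component of the field, and its derivative in `k` is bounded. -/
theorem exists_limit_pushed_arcs {Ω : Set Plane} (hΩb : Bornology.IsBounded Ω) {γ : ℝ → Plane}
    (hγ : ContDiff ℝ 1 γ) (hγ1 : ∀ s, ‖deriv γ s‖ = 1) (hγΩ : ∀ s, γ s ∈ closure Ω)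
    {v : Plane → Plane} (hv : ContinuousOn v (closure Ω))
    (hbd : ∀ s, crossL (v (γ s)) (deriv γ s) = 0) {Ψ : Plane → ℝ} (hΨ : HasStream Ω v Ψ)
    {ν : Plane} (hν : ‖ν‖ = 1) {s₀ ρ : ℝ} (hρ : 0 < ρ)
    (hin : ∀ s k, dist s s₀ < ρ → 0 < k → k < ρ → γ s + k • ν ∈ Ω) :
    ∃ l : ℝ, ∀ δ > 0, ∃ κ > 0, ∀ s k, dist s s₀ < ρ → 0 < k → k < ρ → k < κ →
      |Ψ (γ s + k • ν) - l| < δ := by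
  have hcomp : IsCompact (closure Ω) := hΩb.isCompact_closure
  obtain ⟨M, hM⟩ := hcomp.exists_bound_of_continuousOn hv
  have hM0 : 0 ≤ M := (norm_nonneg _).trans (hM _ (hγΩ 0))
  have hcross : ∀ a b : Plane, ‖crossL a b‖ ≤ ‖a‖ * ‖b‖ := fun a b =>
    ((crossL a).le_opNorm b).trans (mul_le_mul_of_nonneg_right (norm_crossL_le a) (norm_nonneg _))
  have hk : ∀ s k, dist s s₀ < ρ → 0 < k → k < ρ →
      HasDerivAt (fun k => Ψ (γ s + k • ν)) (crossL (v (γ s + k • ν)) ν) k := by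
    intro s k hs h0 h1
    have h2 : HasDerivAt (fun k : ℝ => γ s + k • ν) ν k := by
      simpa using ((hasDerivAt_id k).smul_const ν).const_add (γ s)
    exact (hΨ _ (hin s k hs h0 h1)).comp_hasDerivAt k h2
  have hs : ∀ s k, dist s s₀ < ρ → 0 < k → k < ρ →
      HasDerivAt (fun s => Ψ (γ s + k • ν)) (crossL (v (γ s + k • ν)) (deriv γ s)) s := by
    intro s k hs h0 h1
    have h2 : HasDerivAt (fun s : ℝ => γ s + k • ν) (deriv γ s) s :=
      ((hγ.differentiable (by norm_num)) s).hasDerivAt.add_const _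
    exact (hΨ _ (hin s k hs h0 h1)).comp_hasDerivAt s h2
  have hs₀ : dist s₀ s₀ < ρ := by simpa using hρ
  obtain ⟨g, hgL, hg⟩ : ∃ g : ℝ → ℝ, LipschitzWith ⟨M, hM0⟩ g ∧
      EqOn (fun k => Ψ (γ s₀ + k • ν)) g (Ioo 0 ρ) := by
    refine LipschitzOnWith.extend_real ?_
    refine (convex_Ioo 0 ρ).lipschitzOnWith_of_nnnorm_hasDerivWithin_le
      (fun k hk' => (hk s₀ k hs₀ hk'.1 hk'.2).hasDerivWithinAt) fun k hk' => ?_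
    have := hcross (v (γ s₀ + k • ν)) ν
    rw [hν, mul_one] at this
    exact this.trans (hM _ (subset_closure (hin s₀ k hs₀ hk'.1 hk'.2)))
  refine ⟨g 0, fun δ hδ => ?_⟩
  have hδ' : 0 < δ / (2 * ρ) := by positivity
  obtain ⟨κ, hκ, hκu⟩ := Metric.uniformContinuousOn_iff.1
    (hcomp.uniformContinuousOn_of_continuous hv) _ hδ'
  refine ⟨min κ (δ / (2 * (M + 1))), lt_min hκ (by positivity), fun s k hss h0 h1 h2 => ?_⟩
  have hvert : |Ψ (γ s₀ + k • ν) - g 0| < δ / 2 := by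
    have h3 : Ψ (γ s₀ + k • ν) = g k := hg ⟨h0, h1⟩
    rw [h3]
    have h4 : |g k - g 0| ≤ M * |k - 0| := hgL.dist_le_mul k 0
    rw [sub_zero, abs_of_pos h0] at h4
    have h5 : k < δ / (2 * (M + 1)) := h2.trans_le (min_le_right _ _)
    rw [lt_div_iff₀ (by positivity)] at h5
    nlinarith
  have hhor : |Ψ (γ s + k • ν) - Ψ (γ s₀ + k • ν)| ≤ δ / 2 := by
    have hb : ∀ s ∈ Metric.ball s₀ ρ,
        ‖crossL (v (γ s + k • ν)) (deriv γ s)‖ ≤ δ / (2 * ρ) := by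
      intro s hsb
      have h3 : crossL (v (γ s + k • ν)) (deriv γ s) =
          crossL (v (γ s + k • ν) - v (γ s)) (deriv γ s) := by
        rw [map_sub, sub_apply, hbd s, sub_zero]
      rw [h3]
      refine (hcross _ _).trans ?_
      rw [hγ1, mul_one, ← dist_eq_norm]
      refine (hκu _ (subset_closure (hin s k hsb h0 h1)) _ (hγΩ s) ?_).le
      rw [dist_eq_norm, add_sub_cancel_left, norm_smul, hν, mul_one, Real.norm_eq_abs,
        abs_of_pos h0]
      exact h2.trans_le (min_le_left _ _)
    have h3 := (convex_ball s₀ ρ).norm_image_sub_le_of_norm_hasDerivWithin_le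
      (fun s hsb => (hs s k hsb h0 h1).hasDerivWithinAt) hb (Metric.mem_ball_self hρ) hss
    rw [Real.norm_eq_abs, ← dist_eq_norm] at h3
    refine h3.trans ?_
    calc δ / (2 * ρ) * dist s s₀ ≤ δ / (2 * ρ) * ρ := by gcongr
      _ = δ / 2 := by field_simp
  calc |Ψ (γ s + k • ν) - g 0|
      ≤ |Ψ (γ s + k • ν) - Ψ (γ s₀ + k • ν)| + |Ψ (γ s₀ + k • ν) - g 0| := abs_sub_le _ _ _
    _ < δ := by linarith

/-- Near each boundary point, the stream function of a field tangent to the boundary has at most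
two limiting values, one for each side of the boundary curve. -/
theorem exists_nhds_boundary_values {Ω : Set Plane} {γ : ℝ → Plane} {L : ℝ}
    (hΩ : IsEddyDomain Ω γ L) {v : Plane → Plane} (hv : ContinuousOn v (closure Ω))
    (hbd : ∀ s, crossL (v (γ s)) (deriv γ s) = 0) {Ψ : Plane → ℝ} (hΨ : HasStream Ω v Ψ)
    (s₀ : ℝ) :
    ∃ V ∈ 𝓝 (γ s₀), ∃ S : Set ℝ, S.Finite ∧ ∀ c ∉ S, ∀ q ∈ V ∩ frontier Ω,
      ∀ᶠ x in 𝓝 q, x ∈ Ω → Ψ x ≠ c := by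
  have hγ := hΩ.param.contDiff
  set t := deriv γ s₀ with ht
  have ht1 : ‖t‖ = 1 := hΩ.param.unit_speed s₀
  have ht0 : t ≠ 0 := fun h => by simp [h] at ht1
  have hfr : ∀ s, γ s ∈ frontier Ω := fun s => hΩ.frontier_eq ▸ mem_range_self s
  have hΩfr : ∀ x ∈ Ω, x ∉ frontier Ω := fun x hx hxf =>
    (hΩ.isOpen.inter_frontier_eq ▸ (⟨hx, hxf⟩ : x ∈ Ω ∩ frontier Ω) : x ∈ (∅ : Set Plane))
  set G : ℝ × ℝ → Plane := fun a => γ a.1 + a.2 • rot t with hG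
  have hGc : ContDiff ℝ 1 G := (hγ.comp contDiff_fst).add (contDiff_snd.smul contDiff_const)
  have hGd : HasFDerivAt G ((frame t ht0).symm : ℝ × ℝ →L[ℝ] Plane) (s₀, 0) := by
    have h1 : HasFDerivAt (fun a : ℝ × ℝ => γ a.1) _ (s₀, (0 : ℝ)) :=
      (((hγ.differentiable (by norm_num)) s₀).hasDerivAt.hasFDerivAt).comp (s₀, (0 : ℝ))
        (hasFDerivAt_fst (𝕜 := ℝ) (E := ℝ) (F := ℝ))
    have h2 : HasFDerivAt (fun a : ℝ × ℝ => a.2 • rot t) _ (s₀, (0 : ℝ)) :=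
      (hasFDerivAt_snd (𝕜 := ℝ) (E := ℝ) (F := ℝ)).smul_const (rot t)
    refine (h1.add h2).congr_fderiv (ContinuousLinearMap.ext fun a => ?_)
    simp [frame_symm_apply, ht1, ← ht]
  set P := hGc.contDiffAt.toOpenPartialHomeomorph G hGd (by norm_num) with hP
  have hPG : (P : ℝ × ℝ → Plane) = G := rfl
  have hPs : (s₀, (0 : ℝ)) ∈ P.source :=
    hGc.contDiffAt.mem_toOpenPartialHomeomorph_source hGd (by norm_num)
  obtain ⟨ρ, hρ, hρs⟩ := Metric.isOpen_iff.1 P.open_source _ hPs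
  obtain ⟨d, hd, hdγ⟩ := hΩ.param.exists_dist_lt s₀ hρ
  have hG0 : G (s₀, 0) = γ s₀ := by simp [hG]
  obtain ⟨r, hr, hrs⟩ := Metric.mem_nhds_iff.1 (inter_mem (Metric.ball_mem_nhds (s₀, (0 : ℝ)) hρ)
    (hGc.continuous.continuousAt.preimage_mem_nhds
      (by rw [hG0]; exact Metric.ball_mem_nhds (γ s₀) hd)))
  have hbox : ∀ s k, (s, k) ∈ Metric.ball (s₀, (0 : ℝ)) r ↔ dist s s₀ < r ∧ |k| < r := by
    intro s k
    rw [← ball_prod_same, mem_prod, Metric.mem_ball, Metric.mem_ball, Real.dist_eq k, sub_zero]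
  have himg : ∀ O : Set (ℝ × ℝ), IsOpen O → O ⊆ Metric.ball (s₀, (0 : ℝ)) r → IsOpen (G '' O) :=
    fun O hO hOr => P.isOpen_image_of_subset_source hO
      (hOr.trans (hrs.trans (inter_subset_left.trans hρs)))
  have hfr0 : ∀ a ∈ Metric.ball (s₀, (0 : ℝ)) r, G a ∈ frontier Ω → a.2 = 0 := by
    intro a ha haf
    rw [hΩ.frontier_eq] at haf
    obtain ⟨s, hs⟩ := haf
    obtain ⟨s', hs', hss⟩ := hdγ s (by rw [hs]; exact (hrs ha).2)
    have h1 : ((s', 0) : ℝ × ℝ) ∈ P.source := hρs (by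
      rw [← ball_prod_same]; exact ⟨hs', Metric.mem_ball_self hρ⟩)
    have h2 : G (s', 0) = G a := by rw [← hs, ← hss]; simp [hG]
    rw [← P.injOn h1 (hρs (hrs ha).1) h2]
  -- Each half of the box is mapped into `Ω` or into its complement.
  have hside : ∀ σ : ℝ, |σ| = 1 → ∃ l : ℝ, ∀ δ > 0, ∃ κ > 0, ∀ s k, dist s s₀ < r → 0 < k →
      k < r → k < κ → G (s, σ * k) ∈ Ω → |Ψ (G (s, σ * k)) - l| < δ := by
    intro σ hσ
    have hσb : ∀ s k, dist s s₀ < r → 0 < k → k < r →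
        (s, σ * k) ∈ Metric.ball (s₀, (0 : ℝ)) r := by
      intro s k hs h0 h1
      rw [hbox, abs_mul, hσ, one_mul, abs_of_pos h0]
      exact ⟨hs, h1⟩
    by_cases hex : ∃ s k, dist s s₀ < r ∧ 0 < k ∧ k < r ∧ G (s, σ * k) ∈ Ω
    · obtain ⟨s₁, k₁, hs₁, hk₁, hkr₁, hG₁⟩ := hex
      have hin : ∀ s k, dist s s₀ < r → 0 < k → k < r → G (s, σ * k) ∈ Ω := by
        set H : Set Plane := (fun a : ℝ × ℝ => G (a.1, σ * a.2)) '' (Metric.ball s₀ r ×ˢ Ioo 0 r)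
          with hH
        have hHc : IsPreconnected H := by
          refine ((convex_ball s₀ r).prod (convex_Ioo 0 r)).isPreconnected.image _ ?_
          exact (hGc.continuous.comp (by fun_prop)).continuousOn
        have hsub : H ⊆ Ω := by
          refine hHc.subset_of_closure_inter_subset hΩ.isOpen
            ⟨_, ⟨(s₁, k₁), ⟨hs₁, hk₁, hkr₁⟩, rfl⟩, hG₁⟩ ?_
          rintro _ ⟨hcl, ⟨⟨s, k⟩, ⟨hs, hk0, hkr⟩, rfl⟩⟩
          by_contra hnot
          have h1 := hfr0 _ (hσb s k hs hk0 hkr) ⟨hcl, by rwa [hΩ.isOpen.interior_eq]⟩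
          have h2 : |σ * k| = 0 := by simpa using h1
          rw [abs_mul, hσ, one_mul, abs_of_pos hk0] at h2
          exact hk0.ne' h2
        exact fun s k hs h0 h1 => hsub ⟨(s, k), ⟨hs, h0, h1⟩, rfl⟩
      have hGν : ∀ s k, G (s, σ * k) = γ s + k • (σ • rot t) := fun s k => by
        simp [hG, smul_smul, mul_comm]
      obtain ⟨l, hl⟩ := exists_limit_pushed_arcs hΩ.isBounded hγ hΩ.param.unit_speed
        (fun s => frontier_subset_closure (hfr s)) hv hbd hΨ (ν := σ • rot t)
        (by rw [norm_smul, norm_rot, ht1, mul_one, Real.norm_eq_abs, hσ]) hr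
        (fun s k hs h0 h1 => hGν s k ▸ hin s k hs h0 h1)
      refine ⟨l, fun δ hδ => ?_⟩
      obtain ⟨κ, hκ, h⟩ := hl δ hδ
      exact ⟨κ, hκ, fun s k hs h0 h1 h2 _ => by rw [hGν]; exact h s k hs h0 h1 h2⟩
    · exact ⟨0, fun δ _ => ⟨1, one_pos, fun s k hs h0 h1 _ hmem =>
        absurd ⟨s, k, hs, h0, h1, hmem⟩ hex⟩⟩
  obtain ⟨l₁, hl₁⟩ := hside 1 (by simp)
  obtain ⟨l₂, hl₂⟩ := hside (-1) (by simp)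
  refine ⟨G '' Metric.ball (s₀, 0) r, ?_, {l₁, l₂}, by simp, ?_⟩
  · exact (himg _ Metric.isOpen_ball subset_rfl).mem_nhds ⟨(s₀, 0), Metric.mem_ball_self hr, hG0⟩
  rintro c hc _ ⟨⟨a, ha, rfl⟩, haf⟩
  simp only [mem_insert_iff, mem_singleton_iff, not_or] at hc
  obtain ⟨κ₁, hκ₁, h₁⟩ := hl₁ |c - l₁| (abs_pos.2 (sub_ne_zero.2 hc.1))
  obtain ⟨κ₂, hκ₂, h₂⟩ := hl₂ |c - l₂| (abs_pos.2 (sub_ne_zero.2 hc.2))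
  have hO : IsOpen (Metric.ball (s₀, (0 : ℝ)) r ∩ {b | |b.2| < min κ₁ κ₂}) :=
    Metric.isOpen_ball.inter (isOpen_lt (by fun_prop) continuous_const)
  filter_upwards [(himg _ hO inter_subset_left).mem_nhds
    ⟨a, ⟨ha, by simpa [hfr0 a ha haf] using lt_min hκ₁ hκ₂⟩, rfl⟩]
  rintro _ ⟨⟨s, k⟩, ⟨hb, hk⟩, rfl⟩ hmem hval
  obtain ⟨hs, hkr⟩ := (hbox s k).1 hb
  replace hk := lt_min_iff.1 (show |k| < min κ₁ κ₂ from hk)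
  rcases lt_trichotomy k 0 with h0 | h0 | h0
  · rw [abs_of_neg h0] at hk hkr
    have := h₂ s (-k) hs (by linarith) hkr hk.2 (by simpa using hmem)
    rw [show (-1 : ℝ) * -k = k by ring, hval] at this
    exact lt_irrefl _ this
  · refine hΩfr _ hmem ?_
    rw [h0]
    simpa [hG] using hfr s
  · rw [abs_of_pos h0] at hk hkr
    have := h₁ s k hs h0 hkr hk.1 (by simpa using hmem)
    rw [one_mul, hval] at this
    exact lt_irrefl _ this

/-- The stream function of a field tangent to the boundary of a bounded `C¹` domain has finitely
many limiting values at the boundary; its other level sets are compact subsets of the domain. -/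
theorem exists_finite_isCompact_level {Ω : Set Plane} {γ : ℝ → Plane} {L : ℝ}
    (hΩ : IsEddyDomain Ω γ L) {v : Plane → Plane} (hv : ContinuousOn v (closure Ω))
    (hbd : ∀ s, crossL (v (γ s)) (deriv γ s) = 0) {Ψ : Plane → ℝ} (hΨ : HasStream Ω v Ψ) :
    ∃ S : Set ℝ, S.Finite ∧ ∀ c ∉ S, IsCompact {x | x ∈ Ω ∧ Ψ x = c} := by
  have hcomp : IsCompact (frontier Ω) :=
    hΩ.isBounded.isCompact_closure.of_isClosed_subset isClosed_frontier frontier_subset_closure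
  obtain ⟨S, hS, h⟩ : ∃ S : Set ℝ, S.Finite ∧ ∀ c ∉ S, ∀ q ∈ frontier Ω ∩ frontier Ω,
      ∀ᶠ x in 𝓝 q, x ∈ Ω → Ψ x ≠ c := by
    refine hcomp.induction_on (p := fun A => ∃ S : Set ℝ, S.Finite ∧ ∀ c ∉ S,
      ∀ q ∈ A ∩ frontier Ω, ∀ᶠ x in 𝓝 q, x ∈ Ω → Ψ x ≠ c) ⟨∅, finite_empty, by simp⟩ ?_ ?_ ?_
    · rintro A B hAB ⟨S, hS, h⟩
      exact ⟨S, hS, fun c hc q hq => h c hc q ⟨hAB hq.1, hq.2⟩⟩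
    · rintro A B ⟨S, hS, h⟩ ⟨S', hS', h'⟩
      refine ⟨S ∪ S', hS.union hS', fun c hc q hq => ?_⟩
      rcases hq.1 with hA | hB
      · exact h c (fun hm => hc (Or.inl hm)) q ⟨hA, hq.2⟩
      · exact h' c (fun hm => hc (Or.inr hm)) q ⟨hB, hq.2⟩
    · intro x hx
      rw [hΩ.frontier_eq] at hx
      obtain ⟨s, rfl⟩ := hx
      obtain ⟨V, hV, S, hS, h⟩ := exists_nhds_boundary_values hΩ hv hbd hΨ s
      exact ⟨V, mem_nhdsWithin_of_mem_nhds hV, S, hS, h⟩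
  refine ⟨S, hS, fun c hc => ?_⟩
  refine hΩ.isBounded.isCompact_closure.of_isClosed_subset ?_ fun x hx => subset_closure hx.1
  refine isClosed_of_closure_subset fun x hx => ?_
  have hxcl : x ∈ closure Ω := closure_mono (fun y hy => hy.1) hx
  have hxΩ : x ∈ Ω := by
    by_contra hnot
    have hxf : x ∈ frontier Ω := ⟨hxcl, by rwa [hΩ.isOpen.interior_eq]⟩
    obtain ⟨y, hy, hy'⟩ := (mem_closure_iff_frequently.1 hx).and_eventually
      (h c hc x ⟨hxf, hxf⟩) |>.exists
    exact hy' hy.1 hy.2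
  refine ⟨hxΩ, ?_⟩
  by_contra hne
  obtain ⟨y, hy, hy'⟩ := (mem_closure_iff_frequently.1 hx).and_eventually
    ((hΨ x hxΩ).continuousAt.eventually_ne hne) |>.exists
  exact hy' hy.2

/-! ### The vorticity is constant -/

theorem exists_bump_one_nhds {A N : Set Plane} (hA : IsCompact A) (hN : IsOpen N) (hAN : A ⊆ N) :
    ∃ χ : Plane → ℝ, ContDiff ℝ 1 χ ∧ HasCompactSupport χ ∧ tsupport χ ⊆ N ∧
      (∀ x ∈ A, ∀ᶠ y in 𝓝 x, χ y = 1) ∧ ∀ x, 0 ≤ χ x := by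
  obtain ⟨K, hK, hAK, hKN⟩ := exists_compact_between hA hN hAN
  obtain ⟨f, hf1, hf0, hf⟩ := exists_contMDiffMap_one_nhds_of_subset_interior (n := 1)
    (modelWithCornersSelf ℝ Plane) hA.isClosed hAK
  have hsupp : Function.support f ⊆ K := fun x hx => by
    by_contra h
    exact hx (hf0 x h)
  refine ⟨f, f.contMDiff.contDiff, HasCompactSupport.of_support_subset_isCompact hK hsupp,
    (closure_minimal hsupp hK.isClosed).trans hKN, ?_, fun x => (hf x).1⟩
  exact fun x hx => hf1.filter_mono (nhds_le_nhdsSet hx)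

/-- The level set of the stream function through a regular value splits into a part on which the
vorticity increases across the streamlines and a part on which it does not; both are compact
because the rate of change is locally constant along the level set. A cutoff isolates the first
part, on which the viscous work could not vanish. The hypothesis `hwork` says that the flow does no
viscous work on its streamlines. -/
theorem fderiv_vorticity_rot_eq_zero {Ω : Set Plane} {γ : ℝ → Plane} {L : ℝ}
    (hΩ : IsEddyDomain Ω γ L) {v : Plane → Plane} (hv : ContDiffOn ℝ 2 v Ω)
    (hvc : ContinuousOn v (closure Ω)) (hbd : ∀ s, crossL (v (γ s)) (deriv γ s) = 0)
    (hdiv : ∀ x ∈ Ω, divergence v x = 0) {Ψ : Plane → ℝ} (hΨ : HasStream Ω v Ψ)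
    (htrans : ∀ x ∈ Ω, fderiv ℝ (vorticity v) x (v x) = 0)
    (hwork : ∀ χ : Plane → ℝ, ContDiff ℝ 1 χ → HasCompactSupport χ → tsupport χ ⊆ Ω →
      ∀ η : ℝ → ℝ, ContDiff ℝ 1 η → (∀ t, |η t| ≤ 1) → ∀ δ > 0,
      (∀ x ∈ tsupport χ, fderiv ℝ χ x ≠ 0 → ∀ t, |t - Ψ x| < δ → η t = 0) →
      ∫ x, χ x * η (Ψ x) * inner ℝ (v x) (Δ v x) = 0) {x₀ : Plane} (hx₀ : x₀ ∈ Ω) :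
    fderiv ℝ (vorticity v) x₀ (rot (v x₀)) = 0 := by
  by_contra hq₀
  have hΩo := hΩ.isOpen
  set q : Plane → ℝ := fun x => fderiv ℝ (vorticity v) x (rot (v x)) with hq
  -- Only the sign of the factor `σ` matters: multiplying by it makes `q` positive at `x₀`.
  set σ : ℝ := q x₀ with hσ
  have hω := contDiffOn_vorticity hΩo hv
  have hqc : ContinuousOn q Ω := (hω.continuousOn_fderiv_of_isOpen hΩo (by norm_num)).clm_apply
    (continuous_rot.comp_continuousOn hv.continuousOn)
  set N : Set Plane := {x | x ∈ Ω ∧ 0 < σ * q x} with hN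
  have hNo : IsOpen N :=
    (continuousOn_const.mul hqc).isOpen_inter_preimage hΩo (isOpen_Ioi (a := (0 : ℝ)))
  have hx₀N : x₀ ∈ N := ⟨hx₀, mul_self_pos.2 hq₀⟩
  have hNv : ∀ x ∈ N, v x ≠ 0 := by
    rintro x ⟨-, hx⟩ h0
    have : q x = 0 := by
      simp only [hq, h0]
      rw [← rotL_apply, map_zero, map_zero]
    simp [this] at hx
  -- A value of `Ψ` on `N` that is regular and is not a boundary value.
  obtain ⟨S, hS, hlev⟩ := exists_finite_isCompact_level hΩ hvc hbd hΨ
  have hΨ1 : ContDiffOn ℝ 1 Ψ Ω :=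
    (hΨ.contDiffOn hΩo (n := 2) (by exact_mod_cast hv)).of_le (by norm_num)
  have himg : Ψ '' N ∈ 𝓝 (Ψ x₀) := by
    have hst : HasStrictFDerivAt Ψ (crossL (v x₀)) x₀ := by
      have := (hΨ1.contDiffAt (hΩo.mem_nhds hx₀)).hasStrictFDerivAt (by norm_num)
      rwa [(hΨ x₀ hx₀).fderiv] at this
    rw [← hst.map_nhds_eq_of_surj ?_]
    · exact image_mem_map (hNo.mem_nhds hx₀N)
    · have : crossL (v x₀) ≠ 0 := fun h => hNv x₀ hx₀N (crossL_eq_zero h)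
      exact LinearMap.range_eq_top.2 (LinearMap.surjective
        (fun h => this (ContinuousLinearMap.coe_injective h)))
  obtain ⟨_, ⟨x₁, hx₁, rfl⟩, hc⟩ : ∃ c ∈ Ψ '' N, c ∉ S ∪ Ψ '' {x | x ∈ Ω ∧ v x = 0} := by
    by_contra! h
    have h0 : volume (S ∪ Ψ '' {x | x ∈ Ω ∧ v x = 0}) = 0 :=
      measure_union_null (hS.measure_zero _) (volume_image_critical_eq_zero hΩo hv hΨ)
    exact (Measure.measure_pos_of_mem_nhds volume himg).ne' (measure_mono_null h h0)
  rw [mem_union, not_or] at hc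
  set c := Ψ x₁ with hc_def
  set K : Set Plane := {x | x ∈ Ω ∧ Ψ x = c} with hK
  have hKc : IsCompact K := hlev c hc.1
  have hKv : ∀ x ∈ K, v x ≠ 0 := fun x hx h0 => hc.2 ⟨x, ⟨hx.1, h0⟩, hx.2⟩
  have hAc : IsCompact (K ∩ N) := by
    refine hKc.of_isClosed_subset (isClosed_of_closure_subset fun y hy => ?_) inter_subset_left
    have hyK : y ∈ K := hKc.isClosed.closure_subset (closure_mono inter_subset_left hy)
    refine ⟨hyK, hyK.1, ?_⟩
    obtain ⟨V, hV, hVq⟩ := exists_nhds_ratio_eq hΩo (hv.of_le (by norm_num)) hΨ hω htrans hyK.1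
      (hKv y hyK)
    obtain ⟨z, hzV, hzK, hzN⟩ := mem_closure_iff_nhds.1 hy V hV
    have h1 : q z / ‖v z‖ ^ 2 = q y / ‖v y‖ ^ 2 := hVq z hzV (hzK.2.trans hyK.2.symm)
    have h2 : 0 < ‖v z‖ ^ 2 := pow_pos (norm_pos_iff.2 (hKv z hzK)) 2
    have h3 : 0 < ‖v y‖ ^ 2 := pow_pos (norm_pos_iff.2 (hKv y hyK)) 2
    have h4 : σ * q y = σ * q z / ‖v z‖ ^ 2 * ‖v y‖ ^ 2 := by
      rw [mul_div_assoc, h1, mul_assoc, div_mul_cancel₀ _ h3.ne']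
    rw [h4]
    exact mul_pos (div_pos hzN.2 h2) h3
  obtain ⟨χ, hχ, hχc, hχN, hχ1, hχ0⟩ := exists_bump_one_nhds hAc hNo inter_subset_right
  -- The cutoff is locally constant near the level `c`.
  obtain ⟨r, hr, hrχ⟩ : ∃ r > 0, ∀ x ∈ tsupport χ, fderiv ℝ χ x ≠ 0 → r ≤ |Ψ x - c| := by
    set C : Set Plane := tsupport χ \ interior {x | χ x = 1} with hC
    have hCc : IsCompact C := IsCompact.diff hχc isOpen_interior
    have hcl : IsClosed (Ψ '' C) := (hCc.image_of_continuousOn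
      (hΨ1.continuousOn.mono (sdiff_subset.trans (hχN.trans fun x hx => hx.1)))).isClosed
    have hcC : c ∉ Ψ '' C := by
      rintro ⟨x, ⟨hx, hx1⟩, hxc⟩
      have hxN := hχN hx
      exact hx1 (mem_interior_iff_mem_nhds.2 (hχ1 x ⟨⟨hxN.1, hxc⟩, hxN⟩))
    obtain ⟨r, hr, hrC⟩ := Metric.isOpen_iff.1 hcl.isOpen_compl c hcC
    refine ⟨r, hr, fun x hx hne => ?_⟩
    by_contra! hlt
    refine hrC (by rwa [Metric.mem_ball, Real.dist_eq]) ⟨x, ⟨hx, fun hint => hne ?_⟩, rfl⟩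
    have h1 : χ =ᶠ[𝓝 x] fun _ => 1 := mem_interior_iff_mem_nhds.1 hint
    rw [h1.fderiv_eq]; simp
  set η : ContDiffBump c := ⟨r / 4, r / 2, by positivity, by linarith⟩ with hη
  have hint := hwork χ hχ hχc (hχN.trans fun x hx => hx.1) η η.contDiff
    (fun t => by rw [abs_of_nonneg η.nonneg]; exact η.le_one) (r / 2) (by positivity)
    fun x hx hne t ht => η.zero_of_le_dist (by
      have h1 := hrχ x hx hne
      have h2 := abs_sub_le (Ψ x) t c
      rw [abs_sub_comm (Ψ x) t] at h2
      rw [Real.dist_eq]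
      change r / 2 ≤ |t - c|
      linarith)
  have hpt : ∀ x, χ x * (η (Ψ x) * (σ * q x)) =
      -σ * (χ x * η (Ψ x) * inner ℝ (v x) (Δ v x)) := by
    intro x
    by_cases hx : x ∈ tsupport χ
    · rw [inner_laplacian hΩo hv hdiv (hχN hx).1]; ring
    · rw [image_eq_zero_of_notMem_tsupport hx]; ring
  have hzero : ∫ x, χ x * (η (Ψ x) * (σ * q x)) = 0 := by
    simp_rw [hpt]
    rw [integral_const_mul, hint, mul_zero]
  have hcont : Continuous fun x => χ x * (η (Ψ x) * (σ * q x)) :=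
    continuous_mul_of_tsupport_subset hΩo hχ.continuous (hχN.trans fun x hx => hx.1)
      ((η.continuous.comp_continuousOn hΨ1.continuousOn).mul (continuousOn_const.mul hqc))
  have hpos := hcont.integral_pos_of_hasCompactSupport_nonneg_nonzero (μ := volume) (x := x₁)
    hχc.mul_right (fun x => ?_) ?_
  · exact hpos.ne' hzero
  · by_cases hx : x ∈ tsupport χ
    · exact mul_nonneg (hχ0 x) (mul_nonneg η.nonneg (hχN hx).2.le)
    · simp [image_eq_zero_of_notMem_tsupport hx]
  · have h1 : χ x₁ = 1 := (hχ1 x₁ ⟨⟨hx₁.1, rfl⟩, hx₁⟩).self_of_nhds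
    have h2 : η (Ψ x₁) = 1 := η.one_of_mem_closedBall (Metric.mem_closedBall_self η.rIn_pos.le)
    rw [h1, h2, one_mul, one_mul]
    exact hx₁.2.ne'

theorem fderiv_vorticity_eq_zero {Ω : Set Plane} (hΩ : IsOpen Ω) {v : Plane → Plane}
    (hv : ContDiffOn ℝ 2 v Ω) (h1 : ∀ x ∈ Ω, fderiv ℝ (vorticity v) x (v x) = 0)
    (h2 : ∀ x ∈ Ω, fderiv ℝ (vorticity v) x (rot (v x)) = 0) {x : Plane} (hx : x ∈ Ω) :
    fderiv ℝ (vorticity v) x = 0 := by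
  have hreg : ∀ y ∈ Ω, v y ≠ 0 → fderiv ℝ (vorticity v) y = 0 := by
    intro y hy hvy
    rw [eq_smul_crossL hvy _ (h1 y hy), h2 y hy]; simp
  have hcont : ContinuousAt (fderiv ℝ (vorticity v)) x :=
    ((contDiffOn_vorticity hΩ hv).continuousOn_fderiv_of_isOpen hΩ
      (by norm_num)).continuousAt (hΩ.mem_nhds hx)
  by_contra hne
  -- Otherwise the field vanishes near `x`, and so does its vorticity.
  have hev : ∀ᶠ y in 𝓝 x, v y = 0 := by
    filter_upwards [hcont.eventually_ne hne, hΩ.mem_nhds hx] with y hy hyΩ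
    by_contra h
    exact hy (hreg y hyΩ h)
  have hω : vorticity v =ᶠ[𝓝 x] fun _ => 0 := by
    filter_upwards [hev.eventually_nhds] with y hy
    have : v =ᶠ[𝓝 y] fun _ => 0 := hy
    simp [vorticity, this.fderiv_eq]
  exact hne (by rw [hω.fderiv_eq]; simp)

/-- The vanishing of the viscous work on streamlines passes to a `C²_loc` limit. -/
theorem integral_inner_laplacian_limit_eq_zero {Ω : Set Plane} (hΩ : IsOpen Ω)
    {u : ℕ → Plane → Plane} {p φ : ℕ → Plane → ℝ} {ε : ℕ → ℝ} (hε : ∀ n, ε n ≠ 0)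
    (hu : ∀ n, ContDiffOn ℝ 2 (u n) Ω) (hp : ∀ n, ContDiffOn ℝ 1 (p n) Ω)
    (hmom : ∀ n, ∀ x ∈ Ω, convection (u n) x + ∇ (p n) x - ε n ^ 2 • Δ (u n) x = 0)
    (hdiv : ∀ n, ∀ x ∈ Ω, divergence (u n) x = 0) (hφ : ∀ n, HasStream Ω (u n) (φ n))
    {v : Plane → Plane} (hv : ContDiffOn ℝ 2 v Ω) {Ψ : Plane → ℝ}
    (hu_lim : ∀ K ⊆ Ω, IsCompact K → TendstoUniformlyOn u v atTop K)
    (hlap_lim : ∀ K ⊆ Ω, IsCompact K → TendstoUniformlyOn (fun n => Δ (u n)) (Δ v) atTop K)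
    (hφ_lim : ∀ K ⊆ Ω, IsCompact K → TendstoUniformlyOn φ Ψ atTop K)
    {χ : Plane → ℝ} (hχ : ContDiff ℝ 1 χ) (hχc : HasCompactSupport χ) (hχΩ : tsupport χ ⊆ Ω)
    {η : ℝ → ℝ} (hη : ContDiff ℝ 1 η) (hη1 : ∀ t, |η t| ≤ 1) {δ : ℝ} (hδ : 0 < δ)
    (hloc : ∀ x ∈ tsupport χ, fderiv ℝ χ x ≠ 0 → ∀ t, |t - Ψ x| < δ → η t = 0) :
    ∫ x, χ x * η (Ψ x) * inner ℝ (v x) (Δ v x) = 0 := by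
  have hlim := tendsto_integral_inner_laplacian hΩ hu hv
    (fun n x hx => (hφ n x hx).continuousAt.continuousWithinAt) hχ.continuous hχc hχΩ
    hη.continuous hη1 (hu_lim _ hχΩ hχc) (hlap_lim _ hχΩ hχc) (hφ_lim _ hχΩ hχc)
  refine tendsto_nhds_unique hlim (tendsto_const_nhds.congr' ?_)
  filter_upwards [Metric.tendstoUniformlyOn_iff.1 (hφ_lim _ hχΩ hχc) δ hδ] with n hn
  refine (integral_inner_laplacian_eq_zero hΩ (hε n) (hu n) (hp n) (hmom n) (hdiv n) (hφ n) hχ hχc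
    hχΩ hη fun x hx hne => ?_).symm
  by_contra h
  refine hne (hloc x hx h _ ?_)
  have := hn x hx
  rwa [dist_comm, Real.dist_eq] at this

theorem ConvergesC2Loc.tendsto_velocity {Ω : Set Plane} {u : ℝ → Plane → Plane}
    {v : Plane → Plane} (h : ConvergesC2Loc Ω u v) {K : Set Plane} (hK : K ⊆ Ω)
    (hKc : IsCompact K) : TendstoUniformlyOn u v (𝓝[>] 0) K := by
  have := (ContinuousMultilinearMap.apply ℝ (fun _ : Fin 0 => Plane) Plane
    0).uniformContinuous.comp_tendstoUniformlyOn (h.tendsto K hK hKc 0 (by norm_num))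
  simpa [Function.comp_def] using this

theorem ConvergesC2Loc.tendsto_laplacian {Ω : Set Plane} {u : ℝ → Plane → Plane}
    {v : Plane → Plane} (h : ConvergesC2Loc Ω u v) {K : Set Plane} (hK : K ⊆ Ω)
    (hKc : IsCompact K) : TendstoUniformlyOn (fun ε => Δ (u ε)) (Δ v) (𝓝[>] 0) K := by
  have key : ∀ i : Fin 2, TendstoUniformlyOn (fun ε x => iteratedFDeriv ℝ 2 (u ε) x ![e i, e i])
      (fun x => iteratedFDeriv ℝ 2 v x ![e i, e i]) (𝓝[>] 0) K := fun i =>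
    (ContinuousMultilinearMap.apply ℝ (fun _ : Fin 2 => Plane) Plane
      ![e i, e i]).uniformContinuous.comp_tendstoUniformlyOn (h.tendsto K hK hKc 2 le_rfl)
  have hlap : ∀ w : Plane → Plane, Δ w =
      fun x => iteratedFDeriv ℝ 2 w x ![e 0, e 0] + iteratedFDeriv ℝ 2 w x ![e 1, e 1] := by
    intro w
    funext x
    rw [laplacian_apply, iteratedFDeriv_two_apply, iteratedFDeriv_two_apply]
    rfl
  simp_rw [hlap]
  exact (key 0).add (key 1)

/-! ### Rigid rotation in the disk -/

/-- A holomorphic function in the unit disk whose real part vanishes on the circle is constant,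
hence zero if it vanishes at the origin: the maximum principle applies to `exp (t F)` for every
real `t`. -/
theorem eq_zero_of_re_eq_zero_on_frontier {F : ℂ → ℂ} (hF : DiffContOnCl ℂ F (Metric.ball 0 1))
    (hre : ∀ z ∈ frontier (Metric.ball (0 : ℂ) 1), (F z).re = 0) (h0 : F 0 = 0) {z : ℂ}
    (hz : z ∈ Metric.ball (0 : ℂ) 1) : F z = 0 := by
  have h0b : (0 : ℂ) ∈ Metric.ball (0 : ℂ) 1 := Metric.mem_ball_self one_pos
  have hexp : ∀ t : ℝ, DiffContOnCl ℂ (fun z => Complex.exp (t * F z)) (Metric.ball 0 1) := by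
    intro t
    exact Complex.differentiable_exp.comp_diffContOnCl (hF.const_smul (t : ℂ))
  have hnorm : ∀ (t : ℝ) (w : ℂ), ‖Complex.exp (t * F w)‖ = Real.exp (t * (F w).re) := by
    intro t w
    rw [Complex.norm_exp, Complex.re_ofReal_mul]
  have hle : ∀ t : ℝ, ∀ w ∈ Metric.ball (0 : ℂ) 1, ‖Complex.exp (t * F w)‖ ≤ 1 := by
    intro t w hw
    refine Complex.norm_le_of_forall_mem_frontier_norm_le Metric.isBounded_ball (hexp t)
      (fun w hw => ?_) (subset_closure hw)
    rw [hnorm, hre w hw, mul_zero, Real.exp_zero]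
  have hone : ∀ t : ℝ, Complex.exp (t * F z) = 1 := by
    intro t
    have hmax : IsMaxOn (norm ∘ fun z => Complex.exp (t * F z)) (Metric.ball 0 1) 0 := by
      intro w hw
      simpa [h0] using hle t w hw
    have := Complex.eqOn_of_isPreconnected_of_isMaxOn_norm (convex_ball 0 1).isPreconnected
      Metric.isOpen_ball (hexp t).differentiableOn h0b hmax hz
    simpa [h0] using this
  have hd : HasDerivAt (fun t : ℝ => Complex.exp (t * F z)) (F z) 0 := by
    have h1 : HasDerivAt (fun t : ℝ => (t : ℂ) * F z) (F z) 0 := by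
      simpa using (Complex.ofRealCLM.hasDerivAt (x := 0)).mul_const (F z)
    simpa using h1.cexp
  have hc : (fun t : ℝ => Complex.exp (t * F z)) = fun _ => 1 := funext hone
  rw [hc] at hd
  exact hd.unique (hasDerivAt_const _ _)

/-- A divergence free and curl free field in the unit disk which is tangent to the circle
vanishes: `z ↦ z (v₀ - i v₁)` is holomorphic and its real part is the radial component of `v`
times the radius. -/
theorem eq_zero_of_divergence_vorticity_eq_zero {v : Plane → Plane}
    (hv : DifferentiableOn ℝ v (Metric.ball 0 1))
    (hvc : ContinuousOn v (closure (Metric.ball 0 1)))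
    (hdiv : ∀ x ∈ Metric.ball (0 : Plane) 1, divergence v x = 0)
    (hcurl : ∀ x ∈ Metric.ball (0 : Plane) 1, vorticity v x = 0)
    (hbd : ∀ x : Plane, ‖x‖ = 1 → inner ℝ x (v x) = 0) {x : Plane}
    (hx : x ∈ Metric.ball (0 : Plane) 1) : v x = 0 := by
  set ι : ℂ ≃ₗᵢ[ℝ] Plane := Complex.orthonormalBasisOneI.repr with hι
  have hι0 : ∀ z, ι z 0 = z.re := fun z => by simp [hι]
  have hι1 : ∀ z, ι z 1 = z.im := fun z => by simp [hι]
  have hιb : ∀ z, ι z ∈ Metric.ball (0 : Plane) 1 ↔ z ∈ Metric.ball (0 : ℂ) 1 := by simp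
  set f : ℂ → ℂ := fun z => (v (ι z) 0 : ℂ) - Complex.I * (v (ι z) 1 : ℂ) with hf
  have hfd : ∀ z ∈ Metric.ball (0 : ℂ) 1, DifferentiableAt ℂ f z := by
    intro z hz
    have hzb := (hιb z).2 hz
    have hvd := (hv.differentiableAt (Metric.isOpen_ball.mem_nhds hzb)).hasFDerivAt
    have hcomp : HasFDerivAt (fun z => v (ι z)) ((fderiv ℝ v (ι z)).comp
        (ι.toContinuousLinearEquiv : ℂ →L[ℝ] Plane)) z :=
      hvd.comp z ι.toContinuousLinearEquiv.hasFDerivAt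
    have hco : ∀ i, HasFDerivAt (fun z => (v (ι z) i : ℂ)) _ z := fun i =>
      (Complex.ofRealCLM.comp (EuclideanSpace.proj i : Plane →L[ℝ] ℝ)).hasFDerivAt.comp z hcomp
    have hfz := (hco 0).sub ((hco 1).const_mul Complex.I)
    rw [differentiableAt_complex_iff_differentiableAt_real]
    refine ⟨hfz.differentiableAt, ?_⟩
    have he0 : ι 1 = e 0 := by ext i; fin_cases i <;> simp [hι0, hι1]
    have he1 : ι Complex.I = e 1 := by ext i; fin_cases i <;> simp [hι0, hι1]
    have h1 : fderiv ℝ f z = _ := hfz.fderiv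
    have h2 := hdiv _ hzb
    have h3 := hcurl _ hzb
    rw [divergence] at h2
    rw [vorticity] at h3
    rw [h1]
    simp [he0, he1]
    apply Complex.ext <;> simp <;> linarith
  have hcl : closure (Metric.ball (0 : ℂ) 1) = ι ⁻¹' closure (Metric.ball (0 : Plane) 1) := by
    rw [closure_ball _ one_ne_zero, closure_ball _ one_ne_zero]
    ext z; simp
  have hfc : ContinuousOn f (closure (Metric.ball 0 1)) := by
    have h1 : ContinuousOn (fun z => v (ι z)) (closure (Metric.ball (0 : ℂ) 1)) :=
      hvc.comp ι.continuous.continuousOn (by rw [hcl]; exact mapsTo_preimage _ _)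
    have h2 : ∀ i, ContinuousOn (fun z => (v (ι z) i : ℂ)) (closure (Metric.ball (0 : ℂ) 1)) :=
      fun i => (Complex.ofRealCLM.comp
        (EuclideanSpace.proj i : Plane →L[ℝ] ℝ)).continuous.comp_continuousOn h1
    exact (h2 0).sub (continuousOn_const.mul (h2 1))
  have hF : DiffContOnCl ℂ (fun z => z * f z) (Metric.ball 0 1) :=
    ⟨fun z hz => (differentiableAt_id.mul (hfd z hz)).differentiableWithinAt,
      continuousOn_id.mul hfc⟩
  have hFre : ∀ z ∈ frontier (Metric.ball (0 : ℂ) 1), (z * f z).re = 0 := by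
    intro z hz
    rw [frontier_ball _ one_ne_zero, mem_sphere_zero_iff_norm] at hz
    have := hbd (ι z) (by rw [ι.norm_map, hz])
    rw [inner_eq, hι0, hι1] at this
    simpa [hf] using this
  have hF0 : ∀ z ∈ Metric.ball (0 : ℂ) 1, z * f z = 0 := fun z hz =>
    eq_zero_of_re_eq_zero_on_frontier hF hFre (zero_mul _) hz
  have hf0 : ∀ z ∈ Metric.ball (0 : ℂ) 1, f z = 0 := by
    intro z hz
    rcases eq_or_ne z 0 with rfl | hz0
    · refine tendsto_nhds_unique (((hfd 0 hz).continuousAt.tendsto).mono_left nhdsWithin_le_nhds)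
        ((tendsto_const_nhds (x := (0 : ℂ)) (f := 𝓝[≠] (0 : ℂ))).congr' ?_)
      filter_upwards [self_mem_nhdsWithin,
        mem_nhdsWithin_of_mem_nhds (Metric.isOpen_ball.mem_nhds hz)] with w hw hwb
      exact ((mul_eq_zero.1 (hF0 w hwb)).resolve_left hw).symm
    · exact (mul_eq_zero.1 (hF0 z hz)).resolve_left hz0
  have hfx := hf0 (ι.symm x) ((hιb _).1 (by simpa using hx))
  simp only [hf, ι.apply_symm_apply] at hfx
  have h1 := congrArg Complex.re hfx
  have h2 := congrArg Complex.im hfx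
  simp at h1 h2
  ext i; fin_cases i <;> simp [h1, h2]

/-- In the unit disk an incompressible flow of constant vorticity `a`, tangent to the circle, is
the rigid rotation of angular velocity `a / 2`. -/
theorem eq_rigid_rotation {γ : ℝ → Plane} {L : ℝ} (hγ : IsJordanParam γ L)
    (hfr : frontier (Metric.ball (0 : Plane) 1) = range γ) {v : Plane → Plane} {a : ℝ}
    (hv : DifferentiableOn ℝ v (Metric.ball 0 1))
    (hvc : ContinuousOn v (closure (Metric.ball 0 1)))
    (hdiv : ∀ x ∈ Metric.ball (0 : Plane) 1, divergence v x = 0)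
    (hcurl : ∀ x ∈ Metric.ball (0 : Plane) 1, vorticity v x = a)
    (hbd : ∀ s, crossL (v (γ s)) (deriv γ s) = 0) {x : Plane}
    (hx : x ∈ Metric.ball (0 : Plane) 1) : v x = (a / 2) • rot x := by
  have hd : ∀ y ∈ Metric.ball (0 : Plane) 1, HasFDerivAt (fun y => v y - (a / 2) • rot y)
      (fderiv ℝ v y - (a / 2) • rotL) y := fun y hy =>
    (hv.differentiableAt (Metric.isOpen_ball.mem_nhds hy)).hasFDerivAt.sub
      (rotL.hasFDerivAt.const_smul (a / 2))
  have key := eq_zero_of_divergence_vorticity_eq_zero (v := fun y => v y - (a / 2) • rot y)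
    (fun y hy => (hd y hy).differentiableAt.differentiableWithinAt)
    (hvc.sub (continuous_rot.const_smul (a / 2)).continuousOn) ?_ ?_ ?_ hx
  · exact sub_eq_zero.1 key
  · intro y hy
    have := hdiv y hy
    rw [divergence] at this ⊢
    rw [(hd y hy).fderiv]
    simpa using this
  · intro y hy
    have := hcurl y hy
    rw [vorticity] at this ⊢
    rw [(hd y hy).fderiv]
    simp
    linarith
  · intro y hy
    have hyf : y ∈ range γ := by
      rw [← hfr, frontier_ball _ one_ne_zero]; simpa using hy
    obtain ⟨s, rfl⟩ := hyf
    have hγ1 : ∀ s, inner ℝ (γ s) (γ s) = (1 : ℝ) := by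
      intro s
      have : γ s ∈ frontier (Metric.ball (0 : Plane) 1) := hfr ▸ mem_range_self s
      rw [frontier_ball _ one_ne_zero, mem_sphere_zero_iff_norm] at this
      rw [real_inner_self_eq_norm_sq, this, one_pow]
    have hγd := ((hγ.contDiff.differentiable (by norm_num)) s).hasDerivAt
    -- The position vector is orthogonal to the tangent of the circle.
    have horth : inner ℝ (γ s) (deriv γ s) = 0 := by
      have h1 := hγd.inner ℝ hγd
      simp_rw [hγ1] at h1
      have h2 := h1.unique (hasDerivAt_const s 1)
      rw [real_inner_comm (γ s) (deriv γ s)] at h2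
      linarith
    have hunit : (deriv γ s 0) ^ 2 + (deriv γ s 1) ^ 2 = 1 := by
      rw [← norm_sq_eq, hγ.unit_speed, one_pow]
    have hb := hbd s
    simp only [inner_eq, crossL_apply] at horth hb ⊢
    simp
    set t0 := deriv γ s 0
    set t1 := deriv γ s 1
    linear_combination (-(γ s 0) * v (γ s) 0 - γ s 1 * v (γ s) 1) * hunit +
      (t0 * v (γ s) 0 + t1 * v (γ s) 1) * horth + (γ s 0 * t1 - γ s 1 * t0) * hb

end

end PrandtlBatchelor

theorem mainTheorem10
    (Ω : Set PrandtlBatchelor.Plane) (γ : ℝ → PrandtlBatchelor.Plane) (L : ℝ)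
    (hΩ : PrandtlBatchelor.IsEddyDomain Ω γ L)
    (g : PrandtlBatchelor.Plane → ℝ) (hg : ContDiff ℝ ∞ g)
    (u : ℝ → PrandtlBatchelor.Plane → PrandtlBatchelor.Plane)
    (p ψ : ℝ → PrandtlBatchelor.Plane → ℝ)
    (hNS : ∀ᶠ ε in 𝓝[>] (0 : ℝ), PrandtlBatchelor.IsSteadyNavierStokes Ω γ g ε (u ε) (p ε))
    (hψ : ∀ᶠ ε in 𝓝[>] (0 : ℝ), PrandtlBatchelor.IsStreamFunction Ω (u ε) (ψ ε))
    (heddy : ∀ᶠ ε in 𝓝[>] (0 : ℝ),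
      ∀ x ∈ Ω, ¬ PrandtlBatchelor.IsHyperbolicCriticalPoint (ψ ε) x)
    (ue : PrandtlBatchelor.Plane → PrandtlBatchelor.Plane) (pe : PrandtlBatchelor.Plane → ℝ)
    (hE : PrandtlBatchelor.IsSteadyEuler Ω γ ue pe)
    (hconv : PrandtlBatchelor.ConvergesC2Loc Ω u ue) :
    ∃ a : ℝ, (∀ x ∈ Ω, PrandtlBatchelor.vorticity ue x = a) ∧
      (Ω = Metric.ball 0 1 → ∀ x ∈ Ω, ue x = (a / 2) • PrandtlBatchelor.rot x) := by
  open PrandtlBatchelor in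
  have hΩo := hΩ.isOpen
  have hconn : IsConnected Ω := by
    have := hΩ.simplyConnected
    exact isConnected_iff_connectedSpace.2 inferInstance
  have hpre := hconn.isPreconnected
  have hv := hconv.contDiffOn_limit
  have hbd : ∀ s, crossL (ue (γ s)) (deriv γ s) = 0 := fun s => by
    have := hE.boundary_normal s
    rw [normal, inner_eq] at this
    simp at this
    rw [crossL_apply]
    linarith
  -- Along a sequence of viscosities the hypotheses hold for every index.
  obtain ⟨ε, hε, hall⟩ := exists_seq_forall_of_frequently
    ((hNS.and (hψ.and self_mem_nhdsWithin)).frequently)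
  have hu_lim : ∀ K ⊆ Ω, IsCompact K → TendstoUniformlyOn (fun n => u (ε n)) ue atTop K :=
    fun K hK hKc U hU => hε.eventually (hconv.tendsto_velocity hK hKc U hU)
  have hlap_lim : ∀ K ⊆ Ω, IsCompact K →
      TendstoUniformlyOn (fun n => Δ (u (ε n))) (Δ ue) atTop K :=
    fun K hK hKc U hU => hε.eventually (hconv.tendsto_laplacian hK hKc U hU)
  obtain ⟨Ψ, hΨ, c, hφ_lim⟩ := exists_hasStream_limit hΩo hpre hconn.nonempty
    (fun n => (hall n).2.1.hasStream hΩo) hu_lim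
  have htrans : ∀ x ∈ Ω, fderiv ℝ (vorticity ue) x (ue x) = 0 := fun x hx =>
    fderiv_vorticity_velocity hΩo hv hE.contDiffOn_pressure hE.momentum hE.incompressible hx
  have hcross : ∀ x ∈ Ω, fderiv ℝ (vorticity ue) x (rot (ue x)) = 0 := fun x hx =>
    fderiv_vorticity_rot_eq_zero hΩ hv hE.continuousOn_velocity hbd hE.incompressible hΨ htrans
      (fun χ hχ hχc hχΩ η hη hη1 δ hδ hloc => integral_inner_laplacian_limit_eq_zero hΩo
        (fun n => (hall n).2.2.ne') (fun n => (hall n).1.contDiffOn_velocity)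
        (fun n => (hall n).1.contDiffOn_pressure) (fun n => (hall n).1.momentum)
        (fun n => (hall n).1.incompressible)
        (fun n y hy => ((hall n).2.1.hasStream hΩo y hy).sub_const (c n)) hv hu_lim hlap_lim
        hφ_lim hχ hχc hχΩ hη hη1 hδ hloc) hx
  obtain ⟨a, ha⟩ := hΩo.exists_is_const_of_fderiv_eq_zero hpre
    ((contDiffOn_vorticity hΩo hv).differentiableOn (by norm_num))
    fun x hx => fderiv_vorticity_eq_zero hΩo hv htrans hcross hx
  refine ⟨a, ha, ?_⟩
  rintro rfl x hx
  exact eq_rigid_rotation hΩ.param hΩ.frontier_eq (hv.differentiableOn (by norm_num))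
    hE.continuousOn_velocity hE.incompressible ha hbd hx
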